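/- Let $\mathcal H$ be a real Hilbert space, $m\ge 2$, and let $f_1,\dots,f_m:\mathcal H\to\mathbb R\cup\{\pm\infty\}$ be proper, convex and lower semicontinuous, with conjugates $f_i^*(u)=\sup_{x\in\mathcal H}\{\langle u,x\rangle-f_i(x)\}$, effective domains $\operatorname{dom} f_i=\{f_i<+\infty\}$ and convex subdifferentials $\partial f_i$. Consider the primal problem $$(P)\quad \inf_{x\in\mathcal H}\ \sum_{i=1}^m f_i(x)$$ and the dual problem $$(D)\quad \sup_{v_1,\dots,v_m\in\mathcal H,\ \sum_i v_i=0}\ \Big\{-\sum_{i=1}^m f_i^*(v_i)\Big\},$$ with optimal values $v(P)$ and $v(D)$. Suppose that $(P)$ has an optimal solution and that $$0\in\operatorname{sqri}\Big(\prod_{i=1}^m\operatorname{dom} f_i-\{(x,\dots,x):x\in\mathcal H\}\Big)\quad\text{in } \mathcal H^m,$$ where $\operatorname{sqri}S$ is the set of all $s\in S$ such that $\bigcup_{t>0}t(S-s)$ is a closed linear subspace. Here $\mathcal H^m$ carries the inner product $\langle x,u\rangle=\sum_i\langle x_i,u_i\rangle$. Let $\gamma>0$. Let $(\alpha_k)_{k\ge1}$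 be a nondecreasing real sequence with $0\le\alpha_k\le\alpha<1$ for all $k\ge2$, let $(\lambda_k)_{k\ge1}$ be a real sequence, and let $\lambda,\sigma,\delta>0$ be such that $$\delta>\frac{\alpha^2(1+\alpha)+\alpha\sigma}{1-\alpha^2},\qquad \lambda\le\lambda_k\le 2\cdot\frac{\delta-\alpha[\alpha(1+\alpha)+\alpha\delta+\sigma]}{\delta[1+\alpha(1+\alpha)+\alpha\delta+\sigma]}\quad\text{for all }k\ge2.$$ Suppose that either $\alpha_2=0$ or $\lambda_1=\alpha_1=0$. Let $y_i^0,y_i^1,z_i^0,z_i^1\in\mathcal H$ ($i=1,\dots,m$) be arbitrary and, with $d_i^k=y_i^k-y_i^{k-1}+\gamma(z_i^k-z_i^{k-1})$, define for every $k\ge1$ and $i=1,\dots,m$ $$x^{k+1}=\frac1m\sum_{j=1}^m z_j^k-\frac1{m\gamma}\sum_{j=1}^m y_j^k+\frac{\alpha_k}{m\gamma}\sum_{j=1}^m d_j^k,$$ $$\bar z_i^{k+1}=\alpha_{k+1}\lambda_k(x^{k+1}-z_i^k)+\frac{(1-\lambda_k)\alpha_k\alpha_{k+1}}{\gamma}\,d_i^k,$$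 $$z_i^{k+1}=\operatorname*{argmin}_{z\in\mathcal H}\Big\{f_i(z+\bar z_i^{k+1})+\big\langle -y_i^k-(1-\lambda_k)\alpha_k d_i^k,\,z\big\rangle+\frac\gamma2\big\|z-\lambda_kx^{k+1}-(1-\lambda_k)z_i^k\big\|^2\Big\},$$ $$y_i^{k+1}=y_i^k+\gamma\big(\lambda_kx^{k+1}+(1-\lambda_k)z_i^k-z_i^{k+1}\big)+(1-\lambda_k)\alpha_k d_i^k.$$ Then there exists $(\bar x,\bar v_1,\dots,\bar v_m)\in\mathcal H\times\mathcal H^m$ with $\bar v_i\in\partial f_i(\bar x)$ for $i=1,\dots,m$ and $\sum_{i=1}^m\bar v_i=0$; moreover $\bar x$ is an optimal solution of $(P)$, $(\bar v_1,\dots,\bar v_m)$ is an optimal solution of $(D)$, $v(P)=v(D)$, and, as $k\to+\infty$ and for every $i=1,\dots,m$: 1. $x^k\rightharpoonup\bar x$ weakly; 2. $\bar z_i^k\to0$ strongly; 3. $z_i^k\rightharpoonup\bar x$ weakly; 4. $x^{k+1}-z_i^k\to0$ strongly; 5. $y_i^k\rightharpoonup\bar v_i$ weakly; 6. if $f_j^*$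 is strongly convex for every $j=1,\dots,m$, then $(\bar v_1,\dots,\bar v_m)$ is the unique optimal solution of $(D)$ and $(y_1^k,\dots,y_m^k)\to(\bar v_1,\dots,\bar v_m)$ strongly; 7. $\displaystyle\lim_{k\to+\infty}\sum_{j=1}^m f_j(z_j^k+\bar z_j^k)=v(P)=v(D)=\lim_{k\to+\infty}\Big(-\sum_{j=1}^m f_j^*(y_j^k)\Big).$ -/

import Mathlib

open Filter Topology
open scoped Pointwise

noncomputable section

namespace InertialADMM

variable {H : Type*} [NormedAddCommGroup H] [InnerProductSpace ℝ H]

/-- The product Hilbert space `H ^ m`, with inner product `∑ i, ⟪x i, u i⟫`. -/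
abbrev ProdSpace (H : Type*) [NormedAddCommGroup H] [InnerProductSpace ℝ H] (m : ℕ) : Type _ :=
  PiLp 2 (fun _ : Fin m => H)

/-- Weak convergence of a sequence in `H`. -/
def WeaklyTendsto (u : ℕ → H) (a : H) : Prop :=
  Tendsto (fun k => toWeakSpace ℝ H (u k)) atTop (𝓝 (toWeakSpace ℝ H a))

/-- The effective domain of an extended-real-valued function. -/
def effDom (f : H → EReal) : Set H := {x | f x < ⊤}

/-- A proper function: the effective domain is non-empty and `-∞` is never attained. -/
def IsProperFun (f : H → EReal) : Prop := (effDom f).Nonempty ∧ ∀ x, f x ≠ ⊥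

/-- The class `Γ(H)` of proper, convex, lower semicontinuous functions `H → [-∞, +∞]`. -/
structure IsGamma (f : H → EReal) : Prop where
  proper : IsProperFun f
  convex : ∀ x y : H, ∀ t : ℝ, 0 < t → t < 1 →
    f (t • x + (1 - t) • y) ≤ (t : EReal) * f x + ((1 - t : ℝ) : EReal) * f y
  lsc : LowerSemicontinuous f

/-- The conjugate function `f*(u) = sup_x (⟪u, x⟫ - f x)`. -/
def fenchelConj (f : H → EReal) (u : H) : EReal := ⨆ x : H, ((inner ℝ u x : ℝ) : EReal) - f x

/-- The (convex) subdifferential; it is empty at the points where `f` is not finite. -/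
def subdiff (f : H → EReal) (x : H) : Set H :=
  {v | f x ≠ ⊤ ∧ f x ≠ ⊥ ∧ ∀ y : H, f x + ((inner ℝ v (y - x) : ℝ) : EReal) ≤ f y}

/-- A proper function that is `β`-strongly convex for some `β > 0`. -/
def IsStronglyConvex (f : H → EReal) : Prop :=
  IsProperFun f ∧ ∃ β : ℝ, 0 < β ∧ ∀ x ∈ effDom f, ∀ y ∈ effDom f, ∀ t : ℝ, 0 < t → t < 1 →
    f (t • x + (1 - t) • y) + ((t * (1 - t) * (β / 2 * ‖x - y‖ ^ 2) : ℝ) : EReal)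
      ≤ (t : EReal) * f x + ((1 - t : ℝ) : EReal) * f y

/-- The strong quasi-relative interior of a set `S`: the points `x ∈ S` for which
`⋃_{t > 0} t (S - x)` is a closed linear subspace. -/
def sqri {E : Type*} [NormedAddCommGroup E] [InnerProductSpace ℝ E] (S : Set E) : Set E :=
  {x | x ∈ S ∧ ∃ V : Submodule ℝ E, IsClosed (V : Set E) ∧
    (V : Set E) = ⋃ (t : ℝ) (_ : 0 < t), t • (S - {x})}

variable {m : ℕ}

/-- The set `∏ i, dom f_i` in `H ^ m`. -/
def prodDom (f : Fin m → H → EReal) : Set (ProdSpace H m) := {p | ∀ i, p i ∈ effDom (f i)}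

/-- The diagonal `{(x, …, x) : x ∈ H}` of `H ^ m`. -/
def diag (H : Type*) [NormedAddCommGroup H] [InnerProductSpace ℝ H] (m : ℕ) : Set (ProdSpace H m) :=
  {p | ∃ x : H, ∀ i, p i = x}

/-- The regularity condition `0 ∈ sqri (∏ i, dom f_i - {(x, …, x) : x ∈ H})`. -/
def RegularityCondition (f : Fin m → H → EReal) : Prop :=
  (0 : ProdSpace H m) ∈ sqri (prodDom f - diag H m)

/-- The optimal value of the primal problem `inf_x ∑ i, f_i x`. -/
def primalValue (f : Fin m → H → EReal) : EReal := ⨅ x : H, ∑ i, f i x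

/-- `x` is an optimal solution of the primal problem. -/
def IsPrimalSolution (f : Fin m → H → EReal) (x : H) : Prop :=
  ∀ x' : H, ∑ i, f i x ≤ ∑ i, f i x'

/-- The objective function `v ↦ -∑ i, f_i*(v_i)` of the dual problem. -/
def dualObjective (f : Fin m → H → EReal) (v : ProdSpace H m) : EReal := -∑ i, fenchelConj (f i) (v i)

/-- The optimal value of the dual problem: the supremum of the dual objective over all
`v` with `∑ i, v_i = 0`. -/
def dualValue (f : Fin m → H → EReal) : EReal :=
  ⨆ (v : ProdSpace H m) (_ : ∑ i, v i = 0), dualObjective f v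

/-- `v` is an optimal solution of the dual problem. -/
def IsDualSolution (f : Fin m → H → EReal) (v : ProdSpace H m) : Prop :=
  ∑ i, v i = 0 ∧ ∀ v' : ProdSpace H m, ∑ i, v' i = 0 → dualObjective f v' ≤ dualObjective f v

/-- The optimality conditions: `v_i ∈ ∂f_i(x)` for all `i`, and `∑ i, v_i = 0`. -/
def OptimalityConditions (f : Fin m → H → EReal) (x : H) (v : ProdSpace H m) : Prop :=
  (∀ i, v i ∈ subdiff (f i) x) ∧ ∑ i, v i = 0

/-- The conditions on the parameters of the algorithm: `γ > 0`, the inertial parameters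
`(α_k)_{k ≥ 1}` with their bound `a`, the relaxation parameters `(lam_k)_{k ≥ 1}` with their lower
bound `l`, and the constants `σ, δ`. The values `α 0` and `lam 0` play no role. -/
structure AdmmParameters (γ a l σ δ : ℝ) (α lam : ℕ → ℝ) : Prop where
  gamma_pos : 0 < γ
  monotone : ∀ k, 1 ≤ k → α k ≤ α (k + 1)
  alpha_bounds : ∀ k, 2 ≤ k → 0 ≤ α k ∧ α k ≤ a
  a_lt_one : a < 1
  l_pos : 0 < l
  sigma_pos : 0 < σ
  delta_pos : 0 < δ
  delta_gt : (a ^ 2 * (1 + a) + a * σ) / (1 - a ^ 2) < δ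
  lam_bounds : ∀ k, 2 ≤ k → l ≤ lam k ∧
    lam k ≤ 2 * ((δ - a * (a * (1 + a) + a * δ + σ)) / (δ * (1 + a * (1 + a) + a * δ + σ)))
  start : α 2 = 0 ∨ (lam 1 = 0 ∧ α 1 = 0)

/-- The inertial term `y_i^k - y_i^{k-1} + γ (z_i^k - z_i^{k-1})`, used for `k ≥ 1`. -/
def inertia (γ : ℝ) (y z : ℕ → ProdSpace H m) (k : ℕ) (i : Fin m) : H :=
  y k i - y (k - 1) i + γ • (z k i - z (k - 1) i)

/-- The function minimised in the `z_i`-step number `k ≥ 1`, which defines `z_i^{k+1}`. -/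
def zObjective (f : Fin m → H → EReal) (γ : ℝ) (α lam : ℕ → ℝ) (x : ℕ → H)
    (zbar z y : ℕ → ProdSpace H m) (k : ℕ) (i : Fin m) (w : H) : EReal :=
  f i (w + zbar (k + 1) i) +
    ((inner ℝ (-y k i - ((1 - lam k) * α k) • inertia γ y z k i) w
      + γ / 2 * ‖w - lam k • x (k + 1) - (1 - lam k) • z k i‖ ^ 2 : ℝ) : EReal)

/-- The sequences `(x^k)_{k ≥ 2}`, `(zbar^k)_{k ≥ 2}`, `(z^k)_{k ≥ 0}`, `(y^k)_{k ≥ 0}` are generated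
by the inertial ADMM algorithm; the starting points `y^0, y^1, z^0, z^1` are arbitrary, and the
values of `x` and `zbar` at `0` and `1` play no role. -/
structure IsAdmmSequence (f : Fin m → H → EReal) (γ : ℝ) (α lam : ℕ → ℝ) (x : ℕ → H)
    (zbar z y : ℕ → ProdSpace H m) : Prop where
  x_step : ∀ k, 1 ≤ k →
    x (k + 1) = (1 / (m : ℝ)) • ∑ i, z k i - (1 / ((m : ℝ) * γ)) • ∑ i, y k i
      + (α k / ((m : ℝ) * γ)) • ∑ i, inertia γ y z k i
  zbar_step : ∀ k, 1 ≤ k → ∀ i,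
    zbar (k + 1) i = (α (k + 1) * lam k) • (x (k + 1) - z k i)
      + ((1 - lam k) * α k * α (k + 1) / γ) • inertia γ y z k i
  z_step : ∀ k, 1 ≤ k → ∀ i, ∀ w : H,
    zObjective f γ α lam x zbar z y k i (z (k + 1) i) ≤ zObjective f γ α lam x zbar z y k i w
  y_step : ∀ k, 1 ≤ k → ∀ i,
    y (k + 1) i = y k i + γ • (lam k • x (k + 1) + (1 - lam k) • z k i - z (k + 1) i)
      + ((1 - lam k) * α k) • inertia γ y z k i

end InertialADMM

end

open InertialADMM

/-! The algorithm is an inertial Douglas–Rachford iteration in `H ^ m`. Put `w^k = y^k + γ z^k`. For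
`k ≥ 2` the correction satisfies `γ zbar^k = α_k d^k`, so the extrapolated point `u^k = w^k + α_k
(w^k - w^{k-1})` equals `y^k + γ (z^k + zbar^k)`. The argmin step says `y_i^k ∈ ∂f_i (z_i^k +
zbar_i^k)`, so `u^k` is split as by a resolvent, and `γ x^{k+1}` is the average of the vectors `γ
(z_i^k + zbar_i^k) - y_i^k`. Hence `w^{k+1} = u^k + (λ_k / 2) R^k`, where `u ↦ u + R` is a
reflection through the resolvent followed by a reflection in the diagonal. It fixes the points `v +
γ (x, …, x)` with `(x, v)` an optimal pair, and by monotonicity of the subdifferentials it does not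
move away from them (`norm_reflect_sub_le`).

A Lyapunov argument for inertial Krasnoselskii–Mann steps (`inertial_krasnoselskiiMann`) gives
`w^{k+1} - w^k → 0` and convergence of `‖w^k - q‖` for every such `q`. Since `λ_k` stays away from
zero, the residuals vanish. Every weak cluster point is then an optimal pair
(`optimalityConditions_of_ultrafilter`), and Opial's argument shows that there is only one.
Subgradient inequalities in both directions squeeze the function values. Strong convexity of the
conjugates turns the resulting vanishing dual gap into norm convergence.

All this needs one optimal pair to start from (`exists_optimalityConditions`). It is a subgradient
at zero of the perturbation function `s ↦ inf_y ∑ f_i (s_i + y)`, found by Hahn–Banach in the closed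
subspace supplied by the regularity condition, where Baire's theorem bounds that function above near
zero. -/

namespace InertialADMM

/-! ### Weak convergence along filters and ultrafilters -/

section Weak

variable {H : Type*} [NormedAddCommGroup H] [InnerProductSpace ℝ H] {ι : Type*}

/-- Weak convergence along a filter, expressed through inner products. -/
def InnerTendsto (l : Filter ι) (u : ι → H) (a : H) : Prop :=
  ∀ w : H, Tendsto (fun k => inner ℝ w (u k)) l (𝓝 (inner ℝ w a))

theorem InnerTendsto.add {l : Filter ι} {u v : ι → H} {a b : H} (hu : InnerTendsto l u a)
    (hv : InnerTendsto l v b) : InnerTendsto l (fun k => u k + v k) (a + b) := by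
  intro w
  simpa only [inner_add_right] using (hu w).add (hv w)

theorem InnerTendsto.const_smul {l : Filter ι} {u : ι → H} {a : H} (hu : InnerTendsto l u a)
    (c : ℝ) : InnerTendsto l (fun k => c • u k) (c • a) := by
  intro w
  simpa only [real_inner_smul_right] using (hu w).const_mul c

theorem innerTendsto_of_tendsto {l : Filter ι} {u : ι → H} {a : H} (hu : Tendsto u l (𝓝 a)) :
    InnerTendsto l u a := fun _ => tendsto_const_nhds.inner hu

theorem InnerTendsto.mono {l l' : Filter ι} {u : ι → H} {a : H} (hu : InnerTendsto l u a)
    (h : l' ≤ l) : InnerTendsto l' u a := fun w => (hu w).mono_left h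

theorem InnerTendsto.unique {l : Filter ι} [l.NeBot] {u : ι → H} {a b : H}
    (ha : InnerTendsto l u a) (hb : InnerTendsto l u b) : a = b :=
  ext_inner_left ℝ fun w => tendsto_nhds_unique (ha w) (hb w)

theorem innerTendsto_iff_ultrafilter {l : Filter ι} {u : ι → H} {a : H} :
    InnerTendsto l u a ↔ ∀ g : Ultrafilter ι, ↑g ≤ l → InnerTendsto (g : Filter ι) u a := by
  refine ⟨fun h g hg => h.mono hg, fun h w => ?_⟩
  rw [tendsto_iff_ultrafilter]
  exact fun g hg => h g hg w

theorem InnerTendsto.mem_of_isClosed [CompleteSpace H] {l : Filter ι} [l.NeBot] {u : ι → H} {a : H}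
    (hu : InnerTendsto l u a) {C : Set H} (hC : Convex ℝ C) (hcl : IsClosed C)
    (hmem : ∀ᶠ k in l, u k ∈ C) : a ∈ C := by
  obtain ⟨k₀, hk₀⟩ := hmem.exists
  -- `q` is the projection of `a` onto `C`; its variational inequality passes to the weak limit and
  -- yields `‖a - q‖ ^ 2 ≤ 0`.
  obtain ⟨q, hq, hmin⟩ := exists_norm_eq_iInf_of_complete_convex ⟨_, hk₀⟩ hcl.isComplete hC a
  have hle := (norm_eq_iInf_iff_real_inner_le_zero hC hq).1 hmin
  have hlim : Tendsto (fun k => inner ℝ (a - q) (u k - q)) l (𝓝 (inner ℝ (a - q) (a - q))) := by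
    simpa only [inner_sub_right] using (hu (a - q)).sub_const _
  have h0 : inner ℝ (a - q) (a - q) ≤ 0 :=
    le_of_tendsto hlim (hmem.mono fun k hk => hle _ hk)
  have : a - q = 0 := by
    rw [real_inner_self_eq_norm_sq] at h0
    simpa using le_antisymm h0 (sq_nonneg _)
  rwa [sub_eq_zero.1 this]

/-- Weak compactness of balls: along an ultrafilter each bounded scalar sequence `⟪w, u k⟫`
converges, the limit is linear in `w` and bounded by `B`, and Riesz represents it. Ultrafilters
replace the extraction of subsequences. -/
theorem exists_innerTendsto_ultrafilter [CompleteSpace H] (g : Ultrafilter ι) {u : ι → H} {B : ℝ}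
    (hB : ∀ᶠ k in (g : Filter ι), ‖u k‖ ≤ B) : ∃ a, InnerTendsto (g : Filter ι) u a := by
  have hlim : ∀ w : H, ∃ c ∈ Set.Icc (-(‖w‖ * B)) (‖w‖ * B),
      Tendsto (fun k => inner ℝ w (u k)) g (𝓝 c) := by
    intro w
    have hmem : ∀ᶠ k in (g : Filter ι), inner ℝ w (u k) ∈ Set.Icc (-(‖w‖ * B)) (‖w‖ * B) := by
      filter_upwards [hB] with k hk
      have h1 := abs_real_inner_le_norm w (u k)
      exact abs_le.1 (h1.trans (by gcongr))
    exact (isCompact_Icc.ultrafilter_le_nhds (g.map fun k => inner ℝ w (u k))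
      (le_principal_iff.2 hmem))
  choose c hc hlim using hlim
  have hlin : ∃ L : H →ₗ[ℝ] ℝ, ∀ w, L w = c w :=
    ⟨{ toFun := c
       map_add' := fun x y => tendsto_nhds_unique (hlim (x + y))
          (by simpa only [inner_add_left] using (hlim x).add (hlim y))
       map_smul' := fun r x => tendsto_nhds_unique (hlim (r • x))
          (by simpa [real_inner_smul_left] using (hlim x).const_mul r) }, fun _ => rfl⟩
  obtain ⟨L, hL⟩ := hlin
  let Lc : H →L[ℝ] ℝ := L.mkContinuous B fun w => by
    rw [hL, Real.norm_eq_abs, mul_comm]; exact abs_le.2 (hc w)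
  refine ⟨(InnerProductSpace.toDual ℝ H).symm Lc, fun w => ?_⟩
  rw [real_inner_comm, InnerProductSpace.toDual_symm_apply]
  show Tendsto _ _ (𝓝 (L w))
  rw [hL]
  exact hlim w

theorem tendsto_inner_zero {l : Filter ι} {u v : ι → H} {B : ℝ}
    (hu : Tendsto u l (𝓝 0)) (hv : ∀ᶠ k in l, ‖v k‖ ≤ B) :
    Tendsto (fun k => inner ℝ (u k) (v k)) l (𝓝 0) := by
  refine squeeze_zero_norm' (a := fun k => ‖u k‖ * B) ?_ ?_
  · filter_upwards [hv] with k hk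
    exact (norm_inner_le_norm _ _).trans (by gcongr)
  · simpa using hu.norm.mul_const B

theorem InnerTendsto.weaklyTendsto [CompleteSpace H] {u : ℕ → H} {a : H}
    (h : InnerTendsto atTop u a) : WeaklyTendsto u a := by
  refine (WeakBilin.tendsto_iff_forall_eval_tendsto (topDualPairing ℝ H).flip ?_).2 fun φ => ?_
  · intro x y hxy
    refine ext_inner_left ℝ fun w => ?_
    exact DFunLike.congr_fun hxy (InnerProductSpace.toDual ℝ H w)
  · have := h ((InnerProductSpace.toDual ℝ H).symm φ)
    simp only [InnerProductSpace.toDual_symm_apply] at this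
    exact this

end Weak

/-! ### Extended-real convex functions, subgradients and conjugates -/

section EpiConvex

variable {H : Type*} [NormedAddCommGroup H] [InnerProductSpace ℝ H] {f : H → EReal}

theorem IsGamma.exists_coe (hf : IsGamma f) {x : H} (hx : f x ≠ ⊤) : ∃ r : ℝ, f x = r :=
  ⟨(f x).toReal, (EReal.coe_toReal hx (hf.proper.2 x)).symm⟩

theorem IsGamma.combo_le (hf : IsGamma f) {x y : H} {r s t : ℝ} (hx : f x ≤ r) (hy : f y ≤ s)
    (h0 : 0 ≤ t) (h1 : t ≤ 1) : f (t • x + (1 - t) • y) ≤ ((t * r + (1 - t) * s : ℝ) : EReal) := by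
  rcases h0.eq_or_lt with rfl | h0
  · simpa using hy
  rcases h1.eq_or_lt with rfl | h1
  · simpa using hx
  refine (hf.convex x y t h0 h1).trans ?_
  rw [EReal.coe_add, EReal.coe_mul, EReal.coe_mul]
  have h1' : 0 < 1 - t := sub_pos.2 h1
  exact add_le_add (mul_le_mul_of_nonneg_left hx (by exact_mod_cast h0.le))
    (mul_le_mul_of_nonneg_left hy (by exact_mod_cast h1'.le))

theorem IsGamma.convex_sublevel (hf : IsGamma f) (r : ℝ) : Convex ℝ {x | f x ≤ r} := by
  intro x hx y hy s t hs ht hst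
  obtain rfl : t = 1 - s := by linarith
  have := hf.combo_le (t := s) hx hy hs (by linarith)
  rwa [show s * r + (1 - s) * r = r by ring] at this

theorem IsGamma.isClosed_sublevel (hf : IsGamma f) (r : ℝ) : IsClosed {x | f x ≤ r} :=
  hf.lsc.isClosed_preimage (r : EReal)

theorem IsGamma.le_of_innerTendsto [CompleteSpace H] (hf : IsGamma f) {ι : Type*} {l : Filter ι}
    [l.NeBot] {u : ι → H} {a : H} (hu : InnerTendsto l u a) {r : ℝ} (h : ∀ᶠ k in l, f (u k) ≤ r) :
    f a ≤ r :=
  hu.mem_of_isClosed (hf.convex_sublevel r) (hf.isClosed_sublevel r) h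

theorem IsGamma.mem_subdiff_of_forall_real (hf : IsGamma f) {x v : H} {r : ℝ} (hr : f x = r)
    (h : ∀ y : H, ∀ s : ℝ, f y = s → r + inner ℝ v (y - x) ≤ s) : v ∈ subdiff f x := by
  refine ⟨by simp [hr], by simp [hr], fun y => ?_⟩
  by_cases hy : f y = ⊤
  · simp [hy]
  obtain ⟨s, hs⟩ := hf.exists_coe hy
  rw [hr, hs, ← EReal.coe_add]
  exact_mod_cast h y s hs

theorem exists_coe_of_mem_subdiff {x v : H} (h : v ∈ subdiff f x) : ∃ r : ℝ, f x = r :=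
  ⟨(f x).toReal, (EReal.coe_toReal h.1 h.2.1).symm⟩

theorem le_of_mem_subdiff {x y v : H} {r s : ℝ} (h : v ∈ subdiff f x) (hr : f x = r)
    (hs : f y ≤ s) : r + inner ℝ v (y - x) ≤ s := by
  have := (h.2.2 y).trans hs
  rw [hr, ← EReal.coe_add] at this
  exact_mod_cast this

theorem inner_nonneg_of_mem_subdiff {x y u v : H} (hu : u ∈ subdiff f x) (hv : v ∈ subdiff f y) :
    0 ≤ inner ℝ (u - v) (x - y) := by
  obtain ⟨r, hr⟩ := exists_coe_of_mem_subdiff hu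
  obtain ⟨s, hs⟩ := exists_coe_of_mem_subdiff hv
  have h1 := le_of_mem_subdiff hu hr hs.le
  have h2 := le_of_mem_subdiff hv hs hr.le
  rw [← neg_sub x y, inner_neg_right] at h1
  rw [inner_sub_left]
  linarith

theorem fenchelConj_eq_of_mem_subdiff {x v : H} {r : ℝ} (hv : v ∈ subdiff f x) (hr : f x = r) :
    fenchelConj f v = ((inner ℝ v x - r : ℝ) : EReal) := by
  refine le_antisymm (iSup_le fun y => ?_) ?_
  · by_cases hy : f y = ⊤
    · simp [hy]
    have hy' : f y ≠ ⊥ := by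
      intro h
      have := hv.2.2 y
      rw [h, hr, ← EReal.coe_add] at this
      exact absurd (le_bot_iff.1 this) (EReal.coe_ne_bot _)
    have hs := (EReal.coe_toReal hy hy').symm
    have := le_of_mem_subdiff hv hr hs.le
    rw [inner_sub_right] at this
    rw [hs, ← EReal.coe_sub]
    exact_mod_cast (by linarith)
  · refine le_trans ?_ (le_iSup _ x)
    rw [hr, ← EReal.coe_sub]

theorem IsGamma.fenchelConj_ne_bot (hf : IsGamma f) (v : H) : fenchelConj f v ≠ ⊥ := by
  obtain ⟨x, hx⟩ := hf.proper.1
  obtain ⟨r, hr⟩ := hf.exists_coe (ne_of_lt hx)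
  refine ne_bot_of_le_ne_bot (EReal.coe_ne_bot (inner ℝ v x - r)) (le_trans ?_ (le_iSup _ x))
  rw [hr, ← EReal.coe_sub]

theorem inner_sub_le_fenchelConj {x : H} {r : ℝ} (hr : f x = r) (v : H) :
    ((inner ℝ v x - r : ℝ) : EReal) ≤ fenchelConj f v := by
  refine le_trans ?_ (le_iSup _ x)
  rw [hr, ← EReal.coe_sub]

/-- Fermat's rule for a proximal step, without a sum rule: compare the minimiser with points of the
segment towards `y`. The quadratic term contributes only at order `t ^ 2`, so it disappears after
division by `t` and `t → 0`. -/
theorem IsGamma.mem_subdiff_of_prox (hf : IsGamma f) {γ : ℝ} {b c e z : H}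
    (hz : ∀ w : H, f (z + b) + ((inner ℝ c z + γ / 2 * ‖z - e‖ ^ 2 : ℝ) : EReal)
      ≤ f (w + b) + ((inner ℝ c w + γ / 2 * ‖w - e‖ ^ 2 : ℝ) : EReal)) :
    -c - γ • (z - e) ∈ subdiff f (z + b) := by
  obtain ⟨x₀, hx₀⟩ := hf.proper.1
  have hfin : f (z + b) ≠ ⊤ := by
    intro h
    have := hz (x₀ - b)
    rw [h, EReal.top_add_coe, sub_add_cancel, top_le_iff] at this
    obtain ⟨r, hr⟩ := hf.exists_coe (ne_of_lt hx₀)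
    rw [hr, ← EReal.coe_add] at this
    exact EReal.coe_ne_top _ this
  obtain ⟨r, hr⟩ := hf.exists_coe hfin
  refine hf.mem_subdiff_of_forall_real hr fun y s hs => ?_
  set h : H := y - (z + b) with hh
  have key : ∀ t : ℝ, 0 < t → t < 1 →
      r - s + inner ℝ (-c - γ • (z - e)) h ≤ t * (γ / 2 * ‖h‖ ^ 2) := by
    intro t h0 h1
    have hcomb := hf.combo_le hs.le hr.le h0.le h1.le
    have hpt : t • y + (1 - t) • (z + b) = (z + t • h) + b := by
      rw [hh]; module
    rw [hpt] at hcomb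
    have h2 := (hz (z + t • h)).trans (add_le_add_left hcomb _)
    rw [hr, ← EReal.coe_add, ← EReal.coe_add, EReal.coe_le_coe_iff] at h2
    have hn : ‖z + t • h - e‖ ^ 2 = ‖z - e‖ ^ 2 + 2 * (t * inner ℝ (z - e) h) + t ^ 2 * ‖h‖ ^ 2 := by
      rw [show z + t • h - e = (z - e) + t • h by abel, norm_add_sq_real, real_inner_smul_right,
        norm_smul, mul_pow, Real.norm_eq_abs, sq_abs]
    rw [hn, inner_add_right, real_inner_smul_right] at h2
    rw [inner_sub_left, inner_neg_left, real_inner_smul_left]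
    have : t * (r - s + (-inner ℝ c h - γ * inner ℝ (z - e) h)) ≤ t * (t * (γ / 2 * ‖h‖ ^ 2)) := by
      nlinarith
    exact le_of_mul_le_mul_left this h0
  have hlim : Tendsto (fun t : ℝ => t * (γ / 2 * ‖h‖ ^ 2)) (𝓝[>] 0) (𝓝 0) := by
    have : Tendsto (fun t : ℝ => t * (γ / 2 * ‖h‖ ^ 2)) (𝓝 0) (𝓝 (0 * (γ / 2 * ‖h‖ ^ 2))) :=
      (continuous_id.mul continuous_const).tendsto 0
    rw [zero_mul] at this
    exact this.mono_left nhdsWithin_le_nhds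
  have hfinal : r - s + inner ℝ (-c - γ • (z - e)) h ≤ 0 := by
    refine ge_of_tendsto hlim ?_
    filter_upwards [Ioo_mem_nhdsGT (zero_lt_one' ℝ)] with t ht using key t ht.1 ht.2
  linarith

end EpiConvex

end InertialADMM

namespace InertialADMM

/-! ### Baire's theorem for an increasing family of convex sets -/

section Absorbing

theorem exists_mem_nhds_zero_of_absorbing {V : Type*} [NormedAddCommGroup V] [NormedSpace ℝ V]
    [CompleteSpace V] {C : ℕ → Set V} (hmono : Monotone C) (hconv : ∀ n, Convex ℝ (C n))
    (hcl : ∀ n, IsClosed (C n)) (habs : ∀ s, ∃ t : ℝ, 0 < t ∧ ∃ n, t⁻¹ • s ∈ C n) :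
    ∃ n, C n ∈ 𝓝 (0 : V) := by
  obtain ⟨_, _, n₀, hn₀⟩ := habs 0
  rw [smul_zero] at hn₀
  have hpos : ∀ n : ℕ, (0 : ℝ) < n + 1 := fun n => by positivity
  -- The dilates `(n + 1) • C n` cover `V`; they are closed, so by Baire one of them has an interior
  -- point `s₀`.
  have hcover : ⋃ n : ℕ, {s : V | ((n : ℝ) + 1)⁻¹ • s ∈ C n} = Set.univ := by
    refine Set.eq_univ_of_forall fun s => Set.mem_iUnion.2 ?_
    obtain ⟨t, ht, n₁, hn₁⟩ := habs s
    obtain ⟨n₂, hn₂⟩ := exists_nat_ge t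
    let n := max n₀ (max n₁ n₂)
    have h0 : (0 : V) ∈ C n := hmono (le_max_left _ _) hn₀
    have h1 : t⁻¹ • s ∈ C n := hmono ((le_max_left _ _).trans (le_max_right _ _)) hn₁
    have htn : t ≤ (n : ℝ) + 1 := by
      have : (n₂ : ℝ) ≤ n := by exact_mod_cast (le_max_right _ _).trans (le_max_right _ _)
      linarith
    refine ⟨n, ?_⟩
    have h2 := (hconv n).smul_mem_of_zero_mem h0 h1
      (t := t / ((n : ℝ) + 1)) ⟨by have := hpos n; positivity, (div_le_one (hpos n)).2 htn⟩
    rwa [smul_smul, div_mul_eq_mul_div, mul_inv_cancel₀ ht.ne', one_div] at h2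
  obtain ⟨n, s₀, hs₀⟩ := nonempty_interior_of_iUnion_of_closed
    (fun n : ℕ => (hcl n).preimage (continuous_const_smul ((n : ℝ) + 1)⁻¹)) hcover
  obtain ⟨n', hn'⟩ := Set.mem_iUnion.1 (hcover.symm ▸ Set.mem_univ (-s₀) :
    -s₀ ∈ ⋃ n : ℕ, {s : V | ((n : ℝ) + 1)⁻¹ • s ∈ C n})
  refine ⟨max n n', ?_⟩
  set c : ℝ := ((n : ℝ) + 1)⁻¹ with hc
  set c' : ℝ := ((n' : ℝ) + 1)⁻¹ with hc'
  have hc0 : 0 < c := inv_pos.2 (hpos n)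
  have hc0' : 0 < c' := inv_pos.2 (hpos n')
  have hcont : Tendsto (fun s : V => s₀ + ((c + c') / (c * c')) • s) (𝓝 0) (𝓝 s₀) := by
    have : Continuous fun s : V => s₀ + ((c + c') / (c * c')) • s := by fun_prop
    simpa using this.tendsto 0
  filter_upwards [hcont (mem_interior_iff_mem_nhds.1 hs₀)] with s hs
  have h1 : c • (s₀ + ((c + c') / (c * c')) • s) ∈ C (max n n') := hmono (le_max_left _ _) hs
  have h2 : c' • (-s₀) ∈ C (max n n') := hmono (le_max_right _ _) hn'
  -- The weights make `s₀` cancel against `-s₀`, and the factor `(c + c') / (c * c')` makes the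
  -- remaining coefficient of `s` equal to one.
  have h3 := hconv _ h1 h2 (a := c' / (c + c')) (b := c / (c + c')) (by positivity) (by positivity)
    (by field_simp; ring)
  have h4 : (c' / (c + c')) • (c • (s₀ + ((c + c') / (c * c')) • s)) + (c / (c + c')) • c' • (-s₀)
      = s := by
    have hcc : c + c' ≠ 0 := by positivity
    have hc1 : c ≠ 0 := hc0.ne'
    have hc1' : c' ≠ 0 := hc0'.ne'
    match_scalars
    · field_simp
      ring
    · field_simp
  rwa [h4] at h3

end Absorbing

/-! ### Finite sums of extended reals -/

section ERealSum

theorem coe_finset_sum_real {ι : Type*} (s : Finset ι) (r : ι → ℝ) :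
    ((∑ i ∈ s, r i : ℝ) : EReal) = ∑ i ∈ s, (r i : EReal) := by
  classical
  induction s using Finset.induction_on with
  | empty => simp
  | insert i s hi ih => rw [Finset.sum_insert hi, Finset.sum_insert hi, EReal.coe_add, ih]

theorem finset_sum_ne_bot {ι : Type*} (s : Finset ι) {g : ι → EReal} (hg : ∀ i, g i ≠ ⊥) :
    ∑ i ∈ s, g i ≠ ⊥ := by
  classical
  induction s using Finset.induction_on with
  | empty => simp
  | insert i s hi ih => rw [Finset.sum_insert hi]; exact EReal.add_ne_bot_iff.2 ⟨hg i, ih⟩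

theorem ne_top_of_finset_sum_ne_top {ι : Type*} {s : Finset ι} {g : ι → EReal} (hg : ∀ i, g i ≠ ⊥)
    (hs : ∑ i ∈ s, g i ≠ ⊤) {i : ι} (hi : i ∈ s) : g i ≠ ⊤ := by
  classical
  intro h
  apply hs
  rw [← Finset.add_sum_erase s g hi, h, EReal.top_add_of_ne_bot (finset_sum_ne_bot _ hg)]

end ERealSum

/-! ### Existence of multipliers under the regularity condition -/

section Multiplier

variable {H : Type*} [NormedAddCommGroup H] [InnerProductSpace ℝ H] {m : ℕ}
  {f : Fin m → H → EReal}

/-- A subgradient inequality for the separable sum splits into its components: move only the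
coordinate `j`. -/
theorem mem_subdiff_of_sum (hf : ∀ i, IsGamma (f i)) {x v : Fin m → H} {r : Fin m → ℝ}
    (hr : ∀ i, f i (x i) = r i)
    (h : ∀ (p : Fin m → H) (ρ : Fin m → ℝ), (∀ i, f i (p i) ≤ ρ i) →
      ∑ i, r i + ∑ i, inner ℝ (v i) (p i - x i) ≤ ∑ i, ρ i) (j : Fin m) :
    v j ∈ subdiff (f j) (x j) := by
  refine (hf j).mem_subdiff_of_forall_real (hr j) fun y s hs => ?_
  have hle := h (Function.update x j y) (Function.update r j s) fun i => by
    by_cases hij : i = j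
    · subst hij; simp [hs]
    · simp [hij, hr]
  have h1 : ∑ i, inner ℝ (v i) (Function.update x j y i - x i) = inner ℝ (v j) (y - x j) := by
    rw [Finset.sum_eq_single j (fun i _ hij => by simp [hij]) (by simp)]
    simp
  have h2 : ∑ i, (Function.update r j s i - r i) = s - r j := by
    rw [Finset.sum_eq_single j (fun i _ hij => by simp [hij]) (by simp)]
    simp
  rw [Finset.sum_sub_distrib] at h2
  linarith

theorem exists_values_of_isPrimalSolution (hf : ∀ i, IsGamma (f i)) (hreg : RegularityCondition f)
    {x : H} (hx : IsPrimalSolution f x) :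
    ∃ r : Fin m → ℝ, (∀ i, f i x = r i) ∧
      ∀ (y : H) (ρ : Fin m → ℝ), (∀ i, f i y ≤ ρ i) → ∑ i, r i ≤ ∑ i, ρ i := by
  -- That zero lies in the difference set provides a point common to all the domains, which makes
  -- the optimal value finite.
  obtain ⟨p, hp, d, ⟨x₀, hx₀⟩, hpd⟩ := Set.mem_sub.1 hreg.1
  have hpx : ∀ i, f i x₀ ≠ ⊤ := fun i => by
    rw [← hx₀ i, ← sub_eq_zero.1 hpd]
    exact (hp i).ne
  choose r₀ hr₀ using fun i => (hf i).exists_coe (hpx i)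
  have hfin : ∑ i, f i x ≠ ⊤ := by
    refine ne_top_of_le_ne_top (EReal.coe_ne_top (∑ i, r₀ i)) ((hx x₀).trans ?_)
    rw [coe_finset_sum_real]
    exact Finset.sum_le_sum fun i _ => (hr₀ i).le
  choose r hr using fun i => (hf i).exists_coe
    (ne_top_of_finset_sum_ne_top (fun i => (hf i).proper.2 x) hfin (Finset.mem_univ i))
  refine ⟨r, hr, fun y ρ hρ => ?_⟩
  have h1 : ((∑ i, r i : ℝ) : EReal) ≤ ((∑ i, ρ i : ℝ) : EReal) := by
    rw [coe_finset_sum_real, coe_finset_sum_real]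
    calc ∑ i, (r i : EReal) = ∑ i, f i x := Finset.sum_congr rfl fun i _ => (hr i).symm
      _ ≤ ∑ i, f i y := hx y
      _ ≤ _ := Finset.sum_le_sum fun i _ => hρ i
  exact_mod_cast h1

variable [CompleteSpace H]

theorem exists_bound_near_zero (hf : ∀ i, IsGamma (f i)) {V : Submodule ℝ (ProdSpace H m)}
    (hcl : IsClosed (V : Set (ProdSpace H m)))
    (hV : (V : Set (ProdSpace H m)) = ⋃ (t : ℝ) (_ : 0 < t), t • (prodDom f - diag H m - {0})) :
    ∃ M : ℝ, ∀ᶠ s : V in 𝓝 0, ∃ x : H, ∀ i, f i ((s : ProdSpace H m) i + x) ≤ M := by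
  have : CompleteSpace V := hcl.completeSpace_coe
  -- The bound on `x` is what makes `C n` closed: the witnesses then have weak cluster points, and
  -- sublevel sets of the `f i` are weakly closed.
  let C : ℕ → Set V := fun n => {s | ∃ x : H, ‖x‖ ≤ n ∧ ∀ i, f i ((s : ProdSpace H m) i + x) ≤ (n : ℝ)}
  have hmono : Monotone C := by
    rintro n n' hn s ⟨x, hx, hs⟩
    have hn' : (n : ℝ) ≤ n' := by exact_mod_cast hn
    exact ⟨x, hx.trans hn', fun i => (hs i).trans (by exact_mod_cast hn')⟩
  have hconv : ∀ n, Convex ℝ (C n) := by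
    rintro n s ⟨x, hx, hs⟩ s' ⟨x', hx', hs'⟩ a b ha hb hab
    refine ⟨a • x + b • x', ?_, fun i => ?_⟩
    · have := convex_closedBall (0 : H) n (mem_closedBall_zero_iff.2 hx)
        (mem_closedBall_zero_iff.2 hx') ha hb hab
      exact mem_closedBall_zero_iff.1 this
    · have := (hf i).convex_sublevel n (hs i) (hs' i) ha hb hab
      rw [Set.mem_ofPred_eq] at this
      convert this using 2
      simp only [Submodule.coe_add, Submodule.coe_smul, PiLp.add_apply, PiLp.smul_apply]
      module
  have hclosed : ∀ n, IsClosed (C n) := by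
    intro n
    rw [isClosed_iff_ultrafilter]
    intro s g hgs hgC
    choose! X hX hXf using fun s' (h : s' ∈ C n) => h
    obtain ⟨a, ha⟩ := exists_innerTendsto_ultrafilter g (u := X) (B := n)
      (by filter_upwards [hgC] with s' hs' using hX s' hs')
    refine ⟨a, ?_, fun i => ?_⟩
    · refine mem_closedBall_zero_iff.1 (ha.mem_of_isClosed (convex_closedBall (0 : H) n)
        Metric.isClosed_closedBall ?_)
      filter_upwards [hgC] with s' hs' using mem_closedBall_zero_iff.2 (hX s' hs')
    · have hsi : Tendsto (fun s' : V => (s' : ProdSpace H m) i) g (𝓝 ((s : ProdSpace H m) i)) := by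
        have : Continuous fun s' : V => (s' : ProdSpace H m) i := by fun_prop
        exact (this.tendsto s).mono_left hgs
      refine (hf i).le_of_innerTendsto ((innerTendsto_of_tendsto hsi).add ha) ?_
      filter_upwards [hgC] with s' hs' using hXf s' hs' i
  suffices habs : ∀ s : V, ∃ t : ℝ, 0 < t ∧ ∃ n, t⁻¹ • s ∈ C n by
    obtain ⟨n, hn⟩ := exists_mem_nhds_zero_of_absorbing hmono hconv hclosed habs
    refine ⟨n, ?_⟩
    filter_upwards [hn] with s hs
    obtain ⟨x, -, hx⟩ := hs
    exact ⟨x, hx⟩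
  intro s
  have hs : (s : ProdSpace H m) ∈ ⋃ (t : ℝ) (_ : 0 < t), t • (prodDom f - diag H m - {0}) :=
    hV ▸ s.2
  simp only [Set.mem_iUnion] at hs
  obtain ⟨t, ht, hs⟩ := hs
  refine ⟨t, ht, ?_⟩
  rw [Set.mem_smul_set_iff_inv_smul_mem₀ ht.ne', Set.sub_singleton, Set.mem_image] at hs
  obtain ⟨_, ⟨p, hp, d, ⟨x, hd⟩, rfl⟩, hs⟩ := hs
  choose r hr using fun i => (hf i).exists_coe (hp i).ne
  obtain ⟨n, hn⟩ := exists_nat_ge (‖x‖ + ∑ i, |r i|)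
  have hsum : 0 ≤ ∑ i, |r i| := Finset.sum_nonneg fun i _ => abs_nonneg _
  refine ⟨n, x, by linarith, fun i => ?_⟩
  have h1 : ((t⁻¹ • s : V) : ProdSpace H m) i + x = p i := by
    rw [Submodule.coe_smul, ← hs]
    simp [hd i]
  have h2 : |r i| ≤ ∑ i, |r i| :=
    Finset.single_le_sum (f := fun i => |r i|) (fun i _ => abs_nonneg _) (Finset.mem_univ i)
  rw [h1, hr]
  exact_mod_cast (le_abs_self _).trans (h2.trans ((le_add_of_nonneg_left (norm_nonneg x)).trans hn))

theorem exists_optimalityConditions (hf : ∀ i, IsGamma (f i)) (hreg : RegularityCondition f)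
    {x : H} (hx : IsPrimalSolution f x) :
    ∃ v : ProdSpace H m, OptimalityConditions f x v := by
  obtain ⟨r, hr, hmin⟩ := exists_values_of_isPrimalSolution hf hreg hx
  obtain ⟨-, V, hcl, hV⟩ := hreg
  obtain ⟨M, hM⟩ := exists_bound_near_zero hf hcl hV
  have : CompleteSpace V := hcl.completeSpace_coe
  -- Strict epigraph of the perturbation function, whose value at zero is the primal value `∑ i, r
  -- i`.
  let A : Set (V × ℝ) := {q | ∃ (y : H) (ρ : Fin m → ℝ),
    (∀ i, f i ((q.1 : ProdSpace H m) i + y) ≤ ρ i) ∧ ∑ i, ρ i < q.2}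
  have hA : Convex ℝ A := by
    rintro ⟨s, b⟩ ⟨y, ρ, hρ, hb⟩ ⟨s', b'⟩ ⟨y', ρ', hρ', hb'⟩ c d hc hd hcd
    obtain rfl : d = 1 - c := by linarith
    refine ⟨c • y + (1 - c) • y', fun i => c * ρ i + (1 - c) * ρ' i, fun i => ?_, ?_⟩
    · convert (hf i).combo_le (hρ i) (hρ' i) hc (by linarith) using 2
      simp only [Prod.fst_add, Prod.smul_fst, Submodule.coe_add, Submodule.coe_smul, PiLp.add_apply,
        PiLp.smul_apply]
      module
    · simp only [Prod.snd_add, Prod.smul_snd, smul_eq_mul, Finset.sum_add_distrib,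
        ← Finset.mul_sum]
      simp only at hb hb'
      rcases hc.eq_or_lt with rfl | hc
      · linarith
      · nlinarith
  have hint : ∀ b : ℝ, m * M < b → ((0, b) : V × ℝ) ∈ interior A := by
    intro b hb
    rw [mem_interior_iff_mem_nhds, nhds_prod_eq]
    filter_upwards [hM.prod_mk (Ioi_mem_nhds hb)] with q hq
    obtain ⟨⟨y, hy⟩, hq⟩ := hq
    exact ⟨y, fun _ => M, hy, by simpa using hq⟩
  have hnot : ((0, ∑ i, r i) : V × ℝ) ∉ interior A := by
    intro h
    obtain ⟨y, ρ, hρ, hlt⟩ := interior_subset h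
    exact absurd (hmin y ρ fun i => by simpa using hρ i) (not_le.2 hlt)
  obtain ⟨g, hg⟩ := geometric_hahn_banach_open_point hA.interior isOpen_interior hnot
  have hg' : ∀ q ∈ A, g q ≤ g (0, ∑ i, r i) := by
    intro q hq
    have hq' : q ∈ closure (interior A) := by
      rw [hA.closure_interior_eq_closure_of_nonempty_interior ⟨_, hint _ (lt_add_one _)⟩]
      exact subset_closure hq
    exact closure_minimal (fun q hq => (hg q hq).le)
      (isClosed_le g.continuous continuous_const) hq'
  have hsplit : ∀ (s : V) (b : ℝ), g (s, b) = g (s, 0) + b * g (0, 1) := by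
    intro s b
    rw [show ((s, b) : V × ℝ) = (s, 0) + b • ((0, 1) : V × ℝ) by simp, map_add, map_smul,
      smul_eq_mul]
  set β := g (0, 1) with hβ
  -- The separating hyperplane is not vertical, because interior points of `A` lie above the origin
  -- of `V`. Dividing by `-β` turns the functional into a subgradient `w`.
  have hβneg : β < 0 := by
    have h1 := hg _ (hint (max (m * M) (∑ i, r i) + 1)
      (lt_of_le_of_lt (le_max_left _ _) (lt_add_one _)))
    rw [hsplit, hsplit 0 (∑ i, r i)] at h1
    have h2 := le_max_right (m * M) (∑ i, r i)
    by_contra! h3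
    nlinarith
  let w : V := (InnerProductSpace.toDual ℝ V).symm ((-β)⁻¹ • g.comp (ContinuousLinearMap.inl ℝ V ℝ))
  have hw : ∀ s : V, inner ℝ w s = (-β)⁻¹ * g (s, 0) := fun s => by
    rw [InnerProductSpace.toDual_symm_apply]
    simp
  have key : ∀ (p : Fin m → H) (ρ : Fin m → ℝ) (y : H), (∀ i, f i (p i) ≤ ρ i) →
      ∑ i, r i + ∑ i, inner ℝ ((w : ProdSpace H m) i) (p i - y) ≤ ∑ i, ρ i := by
    intro p ρ y hp
    have hmem : (WithLp.toLp 2 fun i => p i - y : ProdSpace H m) ∈ V := by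
      rw [← SetLike.mem_coe, hV]
      simp only [Set.mem_iUnion]
      refine ⟨1, one_pos, ?_⟩
      rw [one_smul, Set.sub_singleton]
      refine ⟨_, ⟨WithLp.toLp 2 p, fun i => lt_of_le_of_lt (hp i) (EReal.coe_lt_top _),
        WithLp.toLp 2 fun _ => y, ⟨y, fun _ => rfl⟩, rfl⟩, ?_⟩
      ext i
      simp
    let s : V := ⟨_, hmem⟩
    refine le_of_forall_pos_le_add fun ε hε => ?_
    have h1 := hg' (s, ∑ i, ρ i + ε) ⟨y, ρ, fun i => by simpa [s] using hp i, lt_add_of_pos_right _ hε⟩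
    rw [hsplit, hsplit 0 (∑ i, r i), show ((0, 0) : V × ℝ) = 0 from rfl, map_zero] at h1
    have h2 : ∑ i, inner ℝ ((w : ProdSpace H m) i) (p i - y) = inner ℝ w s := by
      rw [Submodule.coe_inner, PiLp.inner_apply]
    rw [h2, hw, add_comm, ← le_sub_iff_add_le, inv_mul_le_iff₀ (by linarith)]
    nlinarith
  refine ⟨w, fun j => mem_subdiff_of_sum hf (x := fun _ => x) hr (fun p ρ hp => key p ρ x hp) j, ?_⟩
  -- Shifting the free point `y` by `∑ i, w i` gives `‖∑ i, w i‖ ^ 2 ≤ 0`.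
  have h1 := key (fun _ => x) r (x - ∑ i, (w : ProdSpace H m) i) (fun i => (hr i).le)
  simp only [sub_sub_cancel, ← sum_inner] at h1
  rw [real_inner_self_eq_norm_sq] at h1
  have h2 := sq_nonneg ‖∑ i, (w : ProdSpace H m) i‖
  have h3 : ‖∑ i, (w : ProdSpace H m) i‖ ^ 2 = 0 := by linarith
  simpa using h3

end Multiplier

end InertialADMM

namespace InertialADMM

/-! ### Real sequences with inertia -/

section RealSequences

theorem tendsto_zero_of_le_mul_add {e ε : ℕ → ℝ} {a : ℝ} (ha0 : 0 ≤ a) (ha1 : a < 1)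
    (he : ∀ n, 0 ≤ e n) (hε : Tendsto ε atTop (𝓝 0)) (h : ∀ n, e (n + 1) ≤ a * e n + ε n) :
    Tendsto e atTop (𝓝 0) := by
  rw [Metric.tendsto_atTop]
  intro r hr
  obtain ⟨N, hN⟩ := eventually_atTop.1
    (hε.eventually_lt_const (show 0 < (1 - a) * (r / 2) by have := sub_pos.2 ha1; positivity))
  have hpow : ∀ j, e (N + j) - r / 2 ≤ a ^ j * |e N - r / 2| := by
    intro j
    induction j with
    | zero => simpa using le_abs_self (e N - r / 2)
    | succ j ih =>
      have h1 := h (N + j)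
      have h2 := hN (N + j) (Nat.le_add_right _ _)
      have h3 := mul_le_mul_of_nonneg_left ih ha0
      rw [← add_assoc, pow_succ']
      linarith
  have hlim : Tendsto (fun j : ℕ => a ^ j * |e N - r / 2|) atTop (𝓝 0) := by
    simpa using (tendsto_pow_atTop_nhds_zero_of_lt_one ha0 ha1).mul_const |e N - r / 2|
  obtain ⟨J, hJ⟩ := eventually_atTop.1 (hlim.eventually_lt_const (half_pos hr))
  refine ⟨N + J, fun n hn => ?_⟩
  obtain ⟨j, rfl⟩ := Nat.exists_eq_add_of_le ((Nat.le_add_right N J).trans hn)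
  have h1 := hpow j
  have h2 := hJ j (by omega)
  rw [Real.dist_eq, sub_zero, abs_of_nonneg (he _)]
  linarith

/-- The energy `φ (n + 1) - α n * φ n + G * D n` drops by at least `σ * D (n + 1)` at each step,
because `α` is nondecreasing. It is bounded below since `a < 1` keeps `φ` bounded, so `D → 0`. Then
`φ (n + 1) - A * φ n` converges with `A = lim α < 1`, a contractive recursion that forces `φ` to
converge. -/
theorem inertial_convergence {φ D α : ℕ → ℝ} {a G σ : ℝ} (hφ : ∀ n, 0 ≤ φ n) (hD : ∀ n, 0 ≤ D n)
    (hα : Monotone α) (hα0 : ∀ n, 0 ≤ α n) (hαa : ∀ n, α n ≤ a) (ha1 : a < 1) (hG : 0 ≤ G)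
    (hσ : 0 < σ)
    (h : ∀ n, φ (n + 2) - φ (n + 1) - α n * (φ (n + 1) - φ n) ≤ G * D n - (G + σ) * D (n + 1)) :
    Tendsto D atTop (𝓝 0) ∧ ∃ L, Tendsto φ atTop (𝓝 L) := by
  have ha0 : 0 ≤ a := (hα0 0).trans (hαa 0)
  set μ : ℕ → ℝ := fun n => φ (n + 1) - α n * φ n + G * D n with hμ
  have hstep : ∀ n, μ (n + 1) ≤ μ n - σ * D (n + 1) := by
    intro n
    have h1 := h n
    have h2 := mul_le_mul_of_nonneg_right (hα n.le_succ) (hφ (n + 1))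
    simp only [hμ]
    simp only [Nat.succ_eq_add_one, add_assoc, Nat.reduceAdd] at h2 ⊢
    linarith
  have hanti : Antitone μ := antitone_nat_of_succ_le fun n => by
    have := mul_nonneg hσ.le (hD (n + 1))
    linarith [hstep n]
  -- Chosen so that `a * B + |μ 0| ≤ B`, which closes the induction.
  set B : ℝ := φ 0 + |μ 0| / (1 - a) with hB
  have ha1' : 0 < 1 - a := sub_pos.2 ha1
  have hbound : ∀ n, φ n ≤ B := by
    intro n
    induction n with
    | zero => exact le_add_of_nonneg_right (by positivity)
    | succ n ih =>
      have h1 : μ n ≤ |μ 0| := (hanti n.zero_le).trans (le_abs_self _)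
      have h2 : α n * φ n ≤ a * B := mul_le_mul (hαa n) ih (hφ n) ha0
      have h3 := mul_nonneg hG (hD n)
      have h4 : (1 - a) * B = (1 - a) * φ 0 + |μ 0| := by rw [hB]; field_simp
      have h5 := mul_nonneg ha1'.le (hφ 0)
      simp only [hμ] at h1 h4
      linarith
  have hbelow : ∀ n, -(a * B) ≤ μ n := fun n => by
    have h2 : α n * φ n ≤ a * B := mul_le_mul (hαa n) (hbound n) (hφ n) ha0
    have h3 := mul_nonneg hG (hD n)
    have h4 := hφ (n + 1)
    simp only [hμ]
    linarith
  have hμlim := tendsto_atTop_ciInf hanti ⟨-(a * B), by rintro _ ⟨n, rfl⟩; exact hbelow n⟩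
  set L := ⨅ n, μ n
  have hDlim : Tendsto D atTop (𝓝 0) := by
    rw [← tendsto_add_atTop_iff_nat 1]
    have h1 : Tendsto (fun n => (μ n - μ (n + 1)) / σ) atTop (𝓝 0) := by
      simpa using (hμlim.sub ((tendsto_add_atTop_iff_nat 1).2 hμlim)).div_const σ
    refine squeeze_zero (fun n => hD _) (fun n => ?_) h1
    rw [le_div_iff₀ hσ]
    linarith [hstep n]
  refine ⟨hDlim, ?_⟩
  have hαlim := tendsto_atTop_ciSup hα ⟨a, by rintro _ ⟨n, rfl⟩; exact hαa n⟩
  set A := ⨆ n, α n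
  have hA0 : 0 ≤ A := ge_of_tendsto' hαlim hα0
  have hA1 : A < 1 := (le_of_tendsto' hαlim hαa).trans_lt ha1
  have hA1' : 0 < 1 - A := sub_pos.2 hA1
  have hprod : Tendsto (fun n => (α n - A) * φ n) atTop (𝓝 0) := by
    have h1 : Tendsto (fun n => ‖α n - A‖ * B) atTop (𝓝 0) := by
      simpa using ((hαlim.sub_const A).norm).mul_const B
    refine squeeze_zero_norm (fun n => ?_) h1
    rw [norm_mul, Real.norm_of_nonneg (hφ n)]
    gcongr
    exact hbound n
  have hdiff : Tendsto (fun n => φ (n + 1) - A * φ n - L) atTop (𝓝 0) := by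
    have h1 := ((hμlim.sub (hDlim.const_mul G)).add hprod).sub_const L
    simp only [mul_zero, sub_zero, add_zero, sub_self] at h1
    refine h1.congr fun n => ?_
    simp only [hμ]
    ring
  have hfix : L / (1 - A) = A * (L / (1 - A)) + L := by field_simp; ring
  refine ⟨L / (1 - A), tendsto_iff_norm_sub_tendsto_zero.2 (tendsto_zero_of_le_mul_add hA0 hA1
    (fun n => norm_nonneg _) (by simpa using hdiff.norm) fun n => ?_)⟩
  have h1 : φ (n + 1) - L / (1 - A) = A * (φ n - L / (1 - A)) + (φ (n + 1) - A * φ n - L) := by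
    linear_combination -hfix
  calc ‖φ (n + 1) - L / (1 - A)‖ ≤ ‖A * (φ n - L / (1 - A))‖ + ‖φ (n + 1) - A * φ n - L‖ := by
        rw [h1]; exact norm_add_le _ _
    _ = _ := by rw [norm_mul, Real.norm_of_nonneg hA0, Real.norm_eq_abs (_ - L)]

end RealSequences

/-! ### Inertial Krasnoselskii–Mann steps -/

section KrasnoselskiiMann

variable {E : Type*} [NormedAddCommGroup E] [InnerProductSpace ℝ E]

theorem relaxed_step_le {u R q : E} {η : ℝ} (h : ‖u + R - q‖ ≤ ‖u - q‖) :
    η * ‖u + η • R - q‖ ^ 2 ≤ η * ‖u - q‖ ^ 2 - (1 - η) * ‖η • R‖ ^ 2 := by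
  have h1 : ‖(u - q) + R‖ ^ 2 ≤ ‖u - q‖ ^ 2 := by
    rw [sub_add_eq_add_sub]
    exact pow_le_pow_left₀ (norm_nonneg _) h 2
  rw [norm_add_sq_real] at h1
  rw [add_sub_right_comm, norm_add_sq_real, norm_smul, real_inner_smul_right, mul_pow,
    Real.norm_eq_abs, sq_abs]
  have h2 := mul_le_mul_of_nonneg_left h1 (sq_nonneg η)
  linarith

/-- Expand the relaxed step and express `η • R` through consecutive increments. Young's inequality
removes their cross term, and `hpar`, the upper bound on the relaxation cleared of fractions, leaves
the coefficient of the new increment larger by `σ` than that of the old one. -/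
theorem inertial_step_le {w₀ w₁ w₂ R q : E} {a t η σ δ : ℝ} (ht0 : 0 ≤ t) (hta : t ≤ a)
    (hη : 0 < η) (hη1 : η ≤ 1) (hσ : 0 < σ) (hδ : 0 < δ)
    (hpar : (a + δ * η) * (a * (1 + a) + a * δ + σ) + δ * η ≤ δ)
    (hw : w₂ = w₁ + t • (w₁ - w₀) + η • R)
    (hR : ‖w₁ + t • (w₁ - w₀) + R - q‖ ≤ ‖w₁ + t • (w₁ - w₀) - q‖) :
    ‖w₂ - q‖ ^ 2 - ‖w₁ - q‖ ^ 2 - t * (‖w₁ - q‖ ^ 2 - ‖w₀ - q‖ ^ 2)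
      ≤ (a * (1 + a) + a * δ) * ‖w₁ - w₀‖ ^ 2
        - (a * (1 + a) + a * δ + σ) * ‖w₂ - w₁‖ ^ 2 := by
  have ha0 : 0 ≤ a := ht0.trans hta
  have h1 := relaxed_step_le (η := η) hR
  rw [← hw] at h1
  have hRd : η • R = (w₂ - w₁) - t • (w₁ - w₀) := by rw [hw]; abel
  set d := w₁ - w₀ with hd
  set d' := w₂ - w₁ with hd'
  set G := a * (1 + a) + a * δ with hG
  have hN : ‖η • R‖ ^ 2 = ‖d'‖ ^ 2 - 2 * t * inner ℝ d' d + t ^ 2 * ‖d‖ ^ 2 := by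
    rw [hRd, norm_sub_sq_real, real_inner_smul_right, norm_smul, mul_pow, Real.norm_eq_abs, sq_abs]
    ring
  have hu : ‖w₁ + t • d - q‖ ^ 2
      = (1 + t) * ‖w₁ - q‖ ^ 2 - t * ‖w₀ - q‖ ^ 2 + t * (1 + t) * ‖d‖ ^ 2 := by
    rw [show w₀ - q = (w₁ - q) - d by rw [hd]; abel, norm_sub_sq_real _ d,
      add_sub_right_comm, norm_add_sq_real, real_inner_smul_right, norm_smul, mul_pow, Real.norm_eq_abs, sq_abs]
    ring
  -- The Young weight: with this `s`, the coefficient of `‖d'‖ ^ 2` is `s - t = δ * η`.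
  set s := t + δ * η with hs
  have hs0 : 0 < s := by positivity
  have hyoung : 2 * s * inner ℝ d' d ≤ ‖d'‖ ^ 2 + s ^ 2 * ‖d‖ ^ 2 := by
    have := sq_nonneg ‖d' - s • d‖
    rw [norm_sub_sq_real, real_inner_smul_right, norm_smul, mul_pow, Real.norm_eq_abs,
      sq_abs] at this
    linarith
  have hX := sq_nonneg ‖d'‖
  have hY := sq_nonneg ‖d‖
  set X := ‖d'‖ ^ 2
  set Y := ‖d‖ ^ 2
  set N := ‖η • R‖ ^ 2
  have hGσ : 0 ≤ G + σ := by positivity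
  have hNlow : η * (δ * X) - η * (s * t * δ * Y) ≤ s * N := by
    have := mul_le_mul_of_nonneg_left hyoung ht0
    rw [hN]
    have e1 : s * (X - 2 * t * inner ℝ d' d + t ^ 2 * Y)
        = s * X - t * (2 * s * inner ℝ d' d) + s * t ^ 2 * Y := by ring
    rw [e1]
    have e2 : s * X - t * (X + s ^ 2 * Y) + s * t ^ 2 * Y
        = η * (δ * X) - η * (s * t * δ * Y) := by rw [hs]; ring
    linarith
  have hcoef : s * (G + σ) ≤ (1 - η) * δ := by
    have : s * (G + σ) ≤ (a + δ * η) * (G + σ) :=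
      mul_le_mul_of_nonneg_right (by rw [hs]; linarith) hGσ
    linarith
  have hlow : η * ((G + σ) * X) - η * ((1 - η) * t * δ * Y) ≤ (1 - η) * N := by
    have h2 := mul_le_mul_of_nonneg_left hNlow (sub_nonneg.2 hη1)
    have h3 := mul_le_mul_of_nonneg_right hcoef (mul_nonneg hη.le hX)
    refine le_of_mul_le_mul_left ?_ hs0
    linarith
  have hGt : t * (1 + t) * Y + (1 - η) * t * δ * Y ≤ G * Y := by
    rw [← add_mul]
    refine mul_le_mul_of_nonneg_right ?_ hY
    have e1 : t * (1 + t) ≤ a * (1 + a) := by gcongr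
    have e2 : (1 - η) * t * δ ≤ a * δ := by
      have : (1 - η) * t ≤ 1 * t := mul_le_mul_of_nonneg_right (by linarith) ht0
      exact mul_le_mul_of_nonneg_right (by linarith) hδ.le
    linarith
  rw [hu] at h1
  refine le_of_mul_le_mul_left ?_ hη
  have h4 := mul_le_mul_of_nonneg_left hGt hη.le
  linarith

theorem inertial_krasnoselskiiMann {w R : ℕ → E} {α η : ℕ → ℝ} {a σ δ : ℝ} {q : E}
    (hα : Monotone α) (hα0 : ∀ n, 0 ≤ α n) (hαa : ∀ n, α n ≤ a) (ha1 : a < 1)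
    (hη : ∀ n, 0 < η n) (hη1 : ∀ n, η n ≤ 1) (hσ : 0 < σ) (hδ : 0 < δ)
    (hpar : ∀ n, (a + δ * η n) * (a * (1 + a) + a * δ + σ) + δ * η n ≤ δ)
    (hw : ∀ n, w (n + 2) = w (n + 1) + α n • (w (n + 1) - w n) + η n • R n)
    (hR : ∀ n, ‖w (n + 1) + α n • (w (n + 1) - w n) + R n - q‖
      ≤ ‖w (n + 1) + α n • (w (n + 1) - w n) - q‖) :
    Tendsto (fun n => w (n + 1) - w n) atTop (𝓝 0) ∧
      ∃ L, Tendsto (fun n => ‖w n - q‖ ^ 2) atTop (𝓝 L) := by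
  have ha0 : 0 ≤ a := (hα0 0).trans (hαa 0)
  obtain ⟨h1, h2⟩ := inertial_convergence (φ := fun n => ‖w n - q‖ ^ 2)
    (D := fun n => ‖w (n + 1) - w n‖ ^ 2) (G := a * (1 + a) + a * δ)
    (fun n => sq_nonneg _) (fun n => sq_nonneg _) hα hα0 hαa ha1 (by positivity) hσ
    (fun n => inertial_step_le (hα0 n) (hαa n) (hη n) (hη1 n) hσ hδ (hpar n) (hw n) (hR n))
  refine ⟨tendsto_zero_iff_norm_tendsto_zero.2 ?_, h2⟩
  simpa [Function.comp_def, Real.sqrt_sq] using (Real.continuous_sqrt.tendsto 0).comp h1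

end KrasnoselskiiMann

end InertialADMM

namespace InertialADMM

variable {H : Type*} [NormedAddCommGroup H] [InnerProductSpace ℝ H] {m : ℕ}
  {f : Fin m → H → EReal}

/-! ### Weak duality, optimal pairs and dual growth -/

section Duality

theorem OptimalityConditions.sum_inner_eq_zero {x : H} {v : ProdSpace H m}
    (h : OptimalityConditions f x v) (y : H) : ∑ i, inner ℝ (v i) y = 0 := by
  rw [← sum_inner, h.2, inner_zero_left]

theorem OptimalityConditions.sum_le {x : H} {v : ProdSpace H m} (h : OptimalityConditions f x v)
    {r : Fin m → ℝ} (hr : ∀ i, f i x = r i) {p : Fin m → H} {ρ : Fin m → ℝ}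
    (hρ : ∀ i, f i (p i) ≤ ρ i) : ∑ i, r i + ∑ i, inner ℝ (v i) (p i) ≤ ∑ i, ρ i := by
  have h1 := Finset.sum_le_sum fun i (_ : i ∈ Finset.univ) =>
    le_of_mem_subdiff (h.1 i) (hr i) (hρ i)
  simp only [inner_sub_right, Finset.sum_add_distrib, Finset.sum_sub_distrib,
    h.sum_inner_eq_zero] at h1
  linarith

theorem OptimalityConditions.isPrimalSolution (hf : ∀ i, IsGamma (f i)) {x : H}
    {v : ProdSpace H m} (h : OptimalityConditions f x v) : IsPrimalSolution f x := by
  intro y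
  by_cases hy : ∑ i, f i y = ⊤
  · simp [hy]
  choose s hs using fun i => (hf i).exists_coe
    (ne_top_of_finset_sum_ne_top (fun i => (hf i).proper.2 y) hy (Finset.mem_univ i))
  choose r hr using fun i => exists_coe_of_mem_subdiff (h.1 i)
  have h1 := h.sum_le hr (p := fun _ => y) fun i => (hs i).le
  rw [h.sum_inner_eq_zero, add_zero] at h1
  simp only [hr, hs, ← coe_finset_sum_real]
  exact_mod_cast h1

theorem OptimalityConditions.primalValue_eq (hf : ∀ i, IsGamma (f i)) {x : H}
    {v : ProdSpace H m} (h : OptimalityConditions f x v) {r : Fin m → ℝ} (hr : ∀ i, f i x = r i) :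
    primalValue f = ((∑ i, r i : ℝ) : EReal) := by
  rw [coe_finset_sum_real, ← Finset.sum_congr rfl fun i _ => hr i]
  exact le_antisymm (iInf_le _ x) (le_iInf (h.isPrimalSolution hf))

theorem OptimalityConditions.dualObjective_eq {x : H}
    {v : ProdSpace H m} (h : OptimalityConditions f x v) {r : Fin m → ℝ} (hr : ∀ i, f i x = r i) :
    dualObjective f v = ((∑ i, r i : ℝ) : EReal) := by
  simp only [dualObjective, fenchelConj_eq_of_mem_subdiff (h.1 _) (hr _), ← coe_finset_sum_real,
    ← EReal.coe_neg, Finset.sum_sub_distrib, h.sum_inner_eq_zero]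
  simp

theorem dualObjective_le {x : H} {r : Fin m → ℝ} (hr : ∀ i, f i x = r i) {v : ProdSpace H m}
    (hv : ∑ i, v i = 0) : dualObjective f v ≤ ((∑ i, r i : ℝ) : EReal) := by
  rw [dualObjective, EReal.neg_le, ← EReal.coe_neg]
  have h1 : (-∑ i, r i : ℝ) = ∑ i, (inner ℝ (v i) x - r i) := by
    rw [Finset.sum_sub_distrib, ← sum_inner, hv, inner_zero_left, zero_sub]
  rw [h1, coe_finset_sum_real]
  exact Finset.sum_le_sum fun i _ => inner_sub_le_fenchelConj (hr i) (v i)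

theorem OptimalityConditions.isDualSolution {x : H} {v : ProdSpace H m}
    (h : OptimalityConditions f x v) : IsDualSolution f v := by
  choose r hr using fun i => exists_coe_of_mem_subdiff (h.1 i)
  refine ⟨h.2, fun v' hv' => ?_⟩
  rw [h.dualObjective_eq hr]
  exact dualObjective_le hr hv'

theorem OptimalityConditions.dualValue_eq {x : H} {v : ProdSpace H m}
    (h : OptimalityConditions f x v) {r : Fin m → ℝ} (hr : ∀ i, f i x = r i) :
    dualValue f = ((∑ i, r i : ℝ) : EReal) := by
  refine le_antisymm (iSup₂_le fun v' hv' => dualObjective_le hr hv') ?_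
  rw [← h.dualObjective_eq hr]
  exact le_iSup₂ (f := fun (v : ProdSpace H m) (_ : ∑ i, v i = 0) => dualObjective f v) v h.2

/-- Here `x` acts as a subgradient of the conjugate at `v`. Strong convexity on the segment from `v`
to `y`, combined with the Fenchel inequality at its points, gives the growth after division by `t`
and `t → 0`. -/
theorem exists_quadratic_growth_conj {g : H → EReal} (hg : IsStronglyConvex (fenchelConj g)) {x v : H}
    (hv : v ∈ subdiff g x) {r : ℝ} (hr : g x = r) :
    ∃ β : ℝ, 0 < β ∧ ∀ (y : H) (s : ℝ), fenchelConj g y = s →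
      inner ℝ y x - r + β * ‖y - v‖ ^ 2 ≤ s := by
  obtain ⟨-, β, hβ, hconv⟩ := hg
  refine ⟨β / 2, half_pos hβ, fun y s hs => ?_⟩
  have hc := fenchelConj_eq_of_mem_subdiff hv hr
  have key : ∀ t : ℝ, 0 < t → t < 1 →
      inner ℝ y x - r + (1 - t) * (β / 2 * ‖y - v‖ ^ 2) ≤ s := by
    intro t h0 h1
    have h2 := hconv y (by simp [effDom, hs]) v
      (by rw [effDom, Set.mem_ofPred_eq, hc]; exact EReal.coe_lt_top _) t h0 h1
    have h3 := inner_sub_le_fenchelConj hr (t • y + (1 - t) • v)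
    have h4 := (add_le_add_left h3 _).trans h2
    rw [hs, hc, ← EReal.coe_mul, ← EReal.coe_mul, ← EReal.coe_add, ← EReal.coe_add,
      EReal.coe_le_coe_iff, inner_add_left, real_inner_smul_left, real_inner_smul_left] at h4
    refine le_of_mul_le_mul_left ?_ h0
    linarith
  have hlim : Tendsto (fun t : ℝ => inner ℝ y x - r + (1 - t) * (β / 2 * ‖y - v‖ ^ 2)) (𝓝[>] 0)
      (𝓝 (inner ℝ y x - r + (1 - 0) * (β / 2 * ‖y - v‖ ^ 2))) := by
    refine Tendsto.mono_left (Continuous.tendsto ?_ 0) nhdsWithin_le_nhds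
    fun_prop
  rw [sub_zero, one_mul] at hlim
  refine le_of_tendsto hlim ?_
  filter_upwards [Ioo_mem_nhdsGT (zero_lt_one' ℝ)] with t ht using key t ht.1 ht.2

end Duality

/-! ### The Douglas–Rachford operator and its weak cluster points -/

section Splitting

/-- The fixed point `v + γ (x, …, x)` attached to a primal-dual pair. -/
def splittingPoint (γ : ℝ) (x : H) (v : ProdSpace H m) : ProdSpace H m :=
  v + γ • WithLp.toLp 2 fun _ => x

/-- The residual `2 γ (X - P_i)` of the Douglas-Rachford operator. -/
def splittingResidual (γ : ℝ) (X : H) (P : ProdSpace H m) : ProdSpace H m :=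
  (2 * γ) • WithLp.toLp 2 fun i => X - P i

/-- After expansion, the change in squared distance is `-4 γ` times the sum of three terms: `⟪X - x,
∑ (γ P_i - Y_i - γ X)⟫`, zero by the choice of `X`; `⟪X - x, ∑ v_i⟫`, zero by dual feasibility; and
`∑ ⟪Y_i - v_i, P_i - x⟫`, nonnegative by monotonicity. -/
theorem norm_reflect_sub_le {γ : ℝ} (hγ : 0 < γ) {x X : H} {v Y P : ProdSpace H m}
    (h : OptimalityConditions f x v) (hY : ∀ i, Y i ∈ subdiff (f i) (P i))
    (hX : ∑ i, (γ • P i - Y i - γ • X) = 0) :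
    ‖Y + γ • P + splittingResidual γ X P - splittingPoint γ x v‖
      ≤ ‖Y + γ • P - splittingPoint γ x v‖ := by
  refine le_of_sq_le_sq ?_ (norm_nonneg _)
  rw [add_sub_right_comm, norm_add_sq_real, add_assoc]
  refine add_le_of_nonpos_right ?_
  rw [← real_inner_self_eq_norm_sq, PiLp.inner_apply, PiLp.inner_apply, Finset.mul_sum,
    ← Finset.sum_add_distrib]
  have hterm : ∀ i, 2 * inner ℝ ((Y + γ • P - splittingPoint γ x v) i) (splittingResidual γ X P i)
      + inner ℝ (splittingResidual γ X P i) (splittingResidual γ X P i)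
      = 4 * γ * (-inner ℝ (X - x) (γ • P i - Y i - γ • X) - inner ℝ (X - x) (v i)
        - inner ℝ (Y i - v i) (P i - x)
        + γ * inner ℝ (X - x) x) - 4 * γ * (γ * inner ℝ (X - x) x) := by
    intro i
    have e1 : (Y + γ • P - splittingPoint γ x v) i = (Y i - v i) + γ • (P i - x) := by
      simp only [splittingPoint, PiLp.add_apply, PiLp.sub_apply, PiLp.smul_apply]
      module
    have e2 : splittingResidual γ X P i = (2 * γ) • ((X - x) - (P i - x)) := by
      simp [splittingResidual]
    have e3 : γ • P i - Y i - γ • X = -(Y i - v i) - v i + γ • (P i - x) - γ • (X - x) := by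
      module
    rw [e1, e2, e3]
    generalize Y i - v i = a
    generalize P i - x = b
    generalize X - x = c
    simp only [inner_add_left, inner_add_right, inner_sub_left, inner_sub_right, inner_neg_right,
      real_inner_smul_left, real_inner_smul_right, real_inner_comm c a, real_inner_comm c b,
      real_inner_comm b a]
    ring
  have hle : ∀ i, 2 * inner ℝ ((Y + γ • P - splittingPoint γ x v) i) (splittingResidual γ X P i)
      + inner ℝ (splittingResidual γ X P i) (splittingResidual γ X P i)
      ≤ -(4 * γ) * inner ℝ (X - x) (γ • P i - Y i - γ • X)
        - 4 * γ * inner ℝ (X - x) (v i) := by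
    intro i
    have := mul_nonneg hγ.le (inner_nonneg_of_mem_subdiff (hY i) (h.1 i))
    rw [hterm]
    linarith
  refine (Finset.sum_le_sum fun i _ => hle i).trans ?_
  rw [Finset.sum_sub_distrib, ← Finset.mul_sum, ← Finset.mul_sum, ← inner_sum, ← inner_sum, hX, h.2]
  simp

/-- By monotonicity the cross term in `‖(Y_i - v_i) + γ (P_i - x)‖ ^ 2` is nonnegative. This bounds
the iterates, and also shows that a splitting point determines its optimal pair. -/
theorem norm_sub_le_of_optimality {γ : ℝ} (hγ : 0 < γ) {x : H} {v Y P : ProdSpace H m}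
    (h : OptimalityConditions f x v) (hY : ∀ i, Y i ∈ subdiff (f i) (P i)) (i : Fin m) :
    ‖Y i - v i‖ ≤ ‖Y + γ • P - splittingPoint γ x v‖ ∧
      γ * ‖P i - x‖ ≤ ‖Y + γ • P - splittingPoint γ x v‖ := by
  have e1 : (Y + γ • P - splittingPoint γ x v) i = (Y i - v i) + γ • (P i - x) := by
    simp only [splittingPoint, PiLp.add_apply, PiLp.sub_apply, PiLp.smul_apply]
    module
  have h1 := PiLp.norm_apply_le (Y + γ • P - splittingPoint γ x v) i
  have h2 := norm_add_sq_real (Y i - v i) (γ • (P i - x))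
  rw [real_inner_smul_right, norm_smul, Real.norm_of_nonneg hγ.le, ← e1] at h2
  have h3 := mul_nonneg hγ.le (inner_nonneg_of_mem_subdiff (hY i) (h.1 i))
  constructor
  · exact (le_of_sq_le_sq (by nlinarith [sq_nonneg (γ * ‖P i - x‖)]) (norm_nonneg _)).trans h1
  · exact (le_of_sq_le_sq (by nlinarith [sq_nonneg ‖Y i - v i‖]) (norm_nonneg _)).trans h1

theorem OptimalityConditions.eq_of_splittingPoint_eq {γ : ℝ} (hγ : 0 < γ) (hm : 0 < m) {x x' : H}
    {v v' : ProdSpace H m} (h : OptimalityConditions f x v) (h' : OptimalityConditions f x' v')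
    (heq : splittingPoint γ x v = splittingPoint γ x' v') : x = x' ∧ v = v' := by
  have hb := fun i => norm_sub_le_of_optimality (Y := v') (P := WithLp.toLp 2 fun _ => x') hγ h h'.1 i
  have h0 : ‖v' + γ • (WithLp.toLp 2 fun _ => x') - splittingPoint γ x v‖ = 0 := by
    rw [heq, splittingPoint, sub_self, norm_zero]
  rw [h0] at hb
  constructor
  · have h1 := (hb ⟨0, hm⟩).2
    have h2 : ‖x' - x‖ ≤ 0 := by
      by_contra! h3
      exact absurd h1 (not_le.2 (mul_pos hγ h3))
    exact (sub_eq_zero.1 (norm_le_zero_iff.1 h2)).symm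
  · ext i
    exact (sub_eq_zero.1 (norm_le_zero_iff.1 (hb i).1)).symm

variable {ι : Type*}

/-- Use `∑ ⟪Y_i, P_i⟫ = ⟪∑ Y_i, X⟫ - ∑ ⟪Y_i, X - P_i⟫`: each product pairs a bounded factor with a
strongly vanishing one. -/
theorem tendsto_sum_inner_zero {l : Filter ι} {X : ι → H} {Y P : ι → ProdSpace H m} {B : ℝ}
    (hY : ∀ i, ∀ᶠ k in l, ‖Y k i‖ ≤ B) (hX : ∀ᶠ k in l, ‖X k‖ ≤ B)
    (hXP : ∀ i, Tendsto (fun k => X k - P k i) l (𝓝 0))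
    (hYs : Tendsto (fun k => ∑ i, Y k i) l (𝓝 0)) :
    Tendsto (fun k => ∑ i, inner ℝ (Y k i) (P k i)) l (𝓝 0) := by
  have h1 := (tendsto_inner_zero hYs hX).sub
    (tendsto_finsetSum Finset.univ fun i _ => tendsto_inner_zero (hXP i) (hY i))
  simp only [Finset.sum_const_zero, sub_zero] at h1
  refine h1.congr fun k => ?_
  rw [sum_inner, ← Finset.sum_sub_distrib]
  refine Finset.sum_congr rfl fun i _ => ?_
  rw [inner_sub_left, real_inner_comm (X k), real_inner_comm (P k i)]
  abel

/-- The individual products `⟪Y_i, P_i⟫` need not pass to weak limits, but their sum tends to zero.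
So the subgradient inequalities are summed before taking the limit, and are split again by
`mem_subdiff_of_sum`. -/
theorem optimalityConditions_of_ultrafilter [CompleteSpace H] (hf : ∀ i, IsGamma (f i)) (hm : 0 < m)
    (g : Ultrafilter ι) {X : ι → H} {Y P : ι → ProdSpace H m} {B : ℝ}
    (hsub : ∀ k i, Y k i ∈ subdiff (f i) (P k i))
    (hYB : ∀ k i, ‖Y k i‖ ≤ B) (hPB : ∀ k i, ‖P k i‖ ≤ B) (hXB : ∀ᶠ k in (g : Filter ι), ‖X k‖ ≤ B)
    (hXP : ∀ i, Tendsto (fun k => X k - P k i) g (𝓝 0))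
    (hYs : Tendsto (fun k => ∑ i, Y k i) g (𝓝 0)) :
    ∃ (x : H) (v : ProdSpace H m), OptimalityConditions f x v ∧
      (∀ i, InnerTendsto (g : Filter ι) (fun k => P k i) x) ∧
      ∀ i, InnerTendsto (g : Filter ι) (fun k => Y k i) (v i) := by
  obtain ⟨x, hx⟩ := exists_innerTendsto_ultrafilter g hXB
  choose v hv using fun i => exists_innerTendsto_ultrafilter g (u := fun k => Y k i) (B := B)
    (Eventually.of_forall fun k => hYB k i)
  have hP : ∀ i, InnerTendsto (g : Filter ι) (fun k => P k i) x := fun i => by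
    have := hx.add ((innerTendsto_of_tendsto (hXP i)).const_smul (-1))
    simpa using this
  have hsum : ∑ i, v i = 0 := by
    refine InnerTendsto.unique (l := (g : Filter ι)) (u := fun k => ∑ i, Y k i) (fun w => ?_)
      (innerTendsto_of_tendsto hYs)
    simp only [inner_sum]
    exact tendsto_finsetSum _ fun i _ => hv i w
  choose s hs using fun k i => exists_coe_of_mem_subdiff (hsub k i)
  have hfin : ∀ i, f i x ≠ ⊤ := fun i => by
    obtain ⟨b, hb⟩ := (hf i).proper.1
    obtain ⟨c, hc⟩ := (hf i).exists_coe hb.ne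
    refine ne_top_of_le_ne_top (EReal.coe_ne_top (c + B * (‖b‖ + B)))
      ((hf i).le_of_innerTendsto (hP i) (Eventually.of_forall fun k => ?_))
    have h1 := le_of_mem_subdiff (hsub k i) (hs k i) hc.le
    have h2 : ‖Y k i‖ * ‖b - P k i‖ ≤ B * (‖b‖ + B) := by
      have hB := (norm_nonneg _).trans (hYB k i)
      exact mul_le_mul (hYB k i) ((norm_sub_le _ _).trans (by gcongr; exact hPB k i))
        (norm_nonneg _) hB
    have h3 := (abs_le.1 (abs_real_inner_le_norm (Y k i) (b - P k i))).1
    rw [hs]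
    exact_mod_cast (by linarith)
  choose r hr using fun i => (hf i).exists_coe (hfin i)
  have hlow : ∀ i, ∀ ε > 0, ∀ᶠ k in (g : Filter ι), r i - ε < s k i := by
    intro i ε hε
    -- Along an ultrafilter, failing to hold eventually means that the opposite inequality holds
    -- eventually, which contradicts weak lower semicontinuity.
    by_contra hcon
    have h1 : ∀ᶠ k in (g : Filter ι), f i (P k i) ≤ ((r i - ε : ℝ) : EReal) := by
      filter_upwards [Ultrafilter.eventually_not.2 hcon] with k hk
      rw [hs]
      exact_mod_cast not_lt.1 hk
    have h2 := (hf i).le_of_innerTendsto (hP i) h1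
    rw [hr, EReal.coe_le_coe_iff] at h2
    linarith
  have hYP := tendsto_sum_inner_zero (fun i => Eventually.of_forall fun k => hYB k i) hXB hXP hYs
  refine ⟨x, WithLp.toLp 2 v, ⟨fun j => ?_, by simpa using hsum⟩, hP, hv⟩
  refine mem_subdiff_of_sum hf (x := fun _ => x) (v := v) hr (fun p ρ hp => ?_) j
  refine le_of_forall_pos_le_add fun ε hε => ?_
  have hm' : (0 : ℝ) < m := by exact_mod_cast hm
  have hlim : Tendsto (fun k => ∑ i, (r i - ε / m) + (∑ i, inner ℝ (p i) (Y k i)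
      - ∑ i, inner ℝ (Y k i) (P k i))) g
      (𝓝 (∑ i, (r i - ε / m) + (∑ i, inner ℝ (p i) (v i) - 0))) :=
    ((tendsto_finsetSum _ fun i _ => hv i (p i)).sub hYP).const_add _
  have h1 : ∑ i, (r i - ε / m) + (∑ i, inner ℝ (p i) (v i) - 0) ≤ ∑ i, ρ i := by
    refine le_of_tendsto hlim ?_
    filter_upwards [eventually_all.2 fun i => hlow i (ε / m) (by positivity)] with k hk
    rw [← Finset.sum_sub_distrib, ← Finset.sum_add_distrib]
    refine Finset.sum_le_sum fun i _ => ?_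
    have h2 := le_of_mem_subdiff (hsub k i) (hs k i) (hp i)
    rw [inner_sub_right, real_inner_comm] at h2
    linarith [hk i]
  have h2 : ∑ i, inner ℝ (v i) (p i - x) = ∑ i, inner ℝ (p i) (v i) := by
    simp only [inner_sub_right, Finset.sum_sub_distrib, ← sum_inner, hsum, inner_zero_left, sub_zero]
    exact Finset.sum_congr rfl fun i _ => real_inner_comm _ _
  have h3 : ∑ i : Fin m, (r i - ε / m) = ∑ i, r i - ε := by
    rw [Finset.sum_sub_distrib]
    simp only [Finset.sum_const, Finset.card_univ, Fintype.card_fin, nsmul_eq_mul]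
    field_simp
  rw [h2]
  linarith

end Splitting

end InertialADMM

/-! ### Weak convergence of the inertial iteration and its consequences -/

namespace InertialADMM

variable {H : Type*} [NormedAddCommGroup H] [InnerProductSpace ℝ H] {m : ℕ}
  {f : Fin m → H → EReal}

theorem inertial_douglasRachford [CompleteSpace H] (hf : ∀ i, IsGamma (f i)) (hm : 0 < m)
    {γ : ℝ} (hγ : 0 < γ) {W Y P : ℕ → ProdSpace H m} {X : ℕ → H} {α η : ℕ → ℝ} {a l σ δ : ℝ}
    (hopt : ∃ (x : H) (v : ProdSpace H m), OptimalityConditions f x v)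
    (hα : Monotone α) (hα0 : ∀ n, 0 ≤ α n) (hαa : ∀ n, α n ≤ a) (ha1 : a < 1) (hl : 0 < l)
    (hη : ∀ n, l ≤ η n) (hη1 : ∀ n, η n ≤ 1) (hσ : 0 < σ) (hδ : 0 < δ)
    (hpar : ∀ n, (a + δ * η n) * (a * (1 + a) + a * δ + σ) + δ * η n ≤ δ)
    (hY : ∀ n i, Y n i ∈ subdiff (f i) (P n i))
    (hX : ∀ n, ∑ i, (γ • P n i - Y n i - γ • X n) = 0)
    (hu : ∀ n, W (n + 1) + α n • (W (n + 1) - W n) = Y n + γ • P n)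
    (hW : ∀ n, W (n + 2) = Y n + γ • P n + η n • splittingResidual γ (X n) (P n)) :
    ∃ (x : H) (v : ProdSpace H m), OptimalityConditions f x v ∧
      (∀ i, InnerTendsto atTop (fun n => P n i) x) ∧
      (∀ i, InnerTendsto atTop (fun n => Y n i) (v i)) ∧
      (∀ i, Tendsto (fun n => X n - P n i) atTop (𝓝 0)) ∧
      Tendsto (fun n => W (n + 1) - W n) atTop (𝓝 0) ∧
      Tendsto (fun n => ∑ i, Y n i) atTop (𝓝 0) ∧
      Tendsto (fun n => ∑ i, inner ℝ (Y n i) (P n i)) atTop (𝓝 0) := by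
  have hKM : ∀ (x : H) (v : ProdSpace H m), OptimalityConditions f x v →
      Tendsto (fun n => W (n + 1) - W n) atTop (𝓝 0) ∧
        ∃ L, Tendsto (fun n => ‖W n - splittingPoint γ x v‖ ^ 2) atTop (𝓝 L) := by
    intro x v h
    refine inertial_krasnoselskiiMann (R := fun n => splittingResidual γ (X n) (P n)) hα hα0 hαa ha1
      (fun n => hl.trans_le (hη n)) hη1 hσ hδ hpar (fun n => ?_) (fun n => ?_)
    · rw [hu, hW]
    · rw [hu]
      exact norm_reflect_sub_le hγ h (hY n) (hX n)
  obtain ⟨x₀, v₀, h₀⟩ := hopt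
  obtain ⟨hd, L₀, hL₀⟩ := hKM x₀ v₀ h₀
  have hαd : Tendsto (fun n => α n • (W (n + 1) - W n)) atTop (𝓝 0) := by
    refine squeeze_zero_norm (fun n => ?_) (tendsto_zero_iff_norm_tendsto_zero.1 hd)
    rw [norm_smul, Real.norm_of_nonneg (hα0 n)]
    exact mul_le_of_le_one_left (norm_nonneg _) ((hαa n).trans ha1.le)
  have hu' : ∀ n, Y n + γ • P n = W (n + 1) + α n • (W (n + 1) - W n) := fun n => (hu n).symm
  have hR : Tendsto (fun n => splittingResidual γ (X n) (P n)) atTop (𝓝 0) := by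
    have h1 : Tendsto (fun n => η n • splittingResidual γ (X n) (P n)) atTop (𝓝 0) := by
      have := ((tendsto_add_atTop_iff_nat 1).2 hd).sub hαd
      rw [sub_zero] at this
      refine this.congr fun n => ?_
      rw [show n + 1 + 1 = n + 2 from rfl, hW, hu']
      abel
    have h2 : Tendsto (fun n => l⁻¹ * ‖η n • splittingResidual γ (X n) (P n)‖) atTop (𝓝 0) := by
      simpa using (tendsto_zero_iff_norm_tendsto_zero.1 h1).const_mul l⁻¹
    refine squeeze_zero_norm (fun n => ?_) h2
    rw [le_inv_mul_iff₀ hl, norm_smul, Real.norm_of_nonneg (hl.le.trans (hη n))]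
    exact mul_le_mul_of_nonneg_right (hη n) (norm_nonneg _)
  have hXP : ∀ i, Tendsto (fun n => X n - P n i) atTop (𝓝 0) := by
    intro i
    have h1 : Tendsto (fun n => (2 * γ)⁻¹ • splittingResidual γ (X n) (P n) i) atTop (𝓝 0) := by
      have hc : Continuous fun R : ProdSpace H m => (2 * γ)⁻¹ • R i := by fun_prop
      simpa [Function.comp_def] using (hc.tendsto 0).comp hR
    refine h1.congr fun n => ?_
    simp only [splittingResidual, PiLp.smul_apply]
    rw [inv_smul_smul₀ (by positivity)]
  have hYs : Tendsto (fun n => ∑ i, Y n i) atTop (𝓝 0) := by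
    have h1 : Tendsto (fun n => ∑ i, (-γ) • (X n - P n i)) atTop (𝓝 0) := by
      simpa using tendsto_finsetSum Finset.univ fun i _ => (hXP i).const_smul (-γ)
    refine h1.congr fun n => ?_
    rw [← sub_eq_zero, ← Finset.sum_sub_distrib, ← hX n]
    refine Finset.sum_congr rfl fun i _ => ?_
    module
  obtain ⟨B, hB⟩ : ∃ B, ∀ n, ‖Y n + γ • P n - splittingPoint γ x₀ v₀‖ ≤ B := by
    obtain ⟨B₁, hB₁⟩ := hL₀.bddAbove_range
    obtain ⟨B₂, hB₂⟩ := hαd.norm.bddAbove_range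
    refine ⟨(B₁ + 1) + B₂, fun n => ?_⟩
    rw [hu', add_sub_right_comm]
    refine (norm_add_le _ _).trans (add_le_add ?_ (hB₂ ⟨n, rfl⟩))
    have h1 : ‖W (n + 1) - splittingPoint γ x₀ v₀‖ ^ 2 ≤ B₁ := hB₁ ⟨n + 1, rfl⟩
    nlinarith [sq_nonneg (‖W (n + 1) - splittingPoint γ x₀ v₀‖ - 1)]
  obtain ⟨C, hYC, hPC, hXC⟩ : ∃ C, (∀ n i, ‖Y n i‖ ≤ C) ∧ (∀ n i, ‖P n i‖ ≤ C) ∧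
      ∀ᶠ n in atTop, ‖X n‖ ≤ C := by
    have hB0 : 0 ≤ B := (norm_nonneg _).trans (hB 0)
    have hYn : ∀ n i, ‖Y n i‖ ≤ ‖v₀‖ + B := fun n i => by
      have h1 := (norm_sub_le_of_optimality hγ h₀ (hY n) i).1.trans (hB n)
      have h2 := norm_le_norm_add_norm_sub' (Y n i) (v₀ i)
      have h3 := PiLp.norm_apply_le v₀ i
      linarith
    have hPn : ∀ n i, ‖P n i‖ ≤ ‖x₀‖ + B / γ := fun n i => by
      have h1 := (norm_sub_le_of_optimality hγ h₀ (hY n) i).2.trans (hB n)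
      rw [mul_comm, ← le_div_iff₀ hγ] at h1
      have h2 := norm_le_norm_add_norm_sub' (P n i) x₀
      linarith
    have hBγ : 0 ≤ B / γ := by positivity
    refine ⟨(‖v₀‖ + B) + (‖x₀‖ + B / γ) + 1, fun n i => ?_, fun n i => ?_, ?_⟩
    · linarith [hYn n i, norm_nonneg x₀]
    · linarith [hPn n i, norm_nonneg v₀]
    · have h1 := (tendsto_zero_iff_norm_tendsto_zero.1 (hXP ⟨0, hm⟩)).eventually_lt_const one_pos
      filter_upwards [h1] with n hn
      have h2 := norm_le_norm_add_norm_sub' (X n) (P n ⟨0, hm⟩)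
      linarith [hPn n ⟨0, hm⟩, norm_nonneg v₀]
  have hcluster := fun (g : Ultrafilter ℕ) (hg : (g : Filter ℕ) ≤ atTop) =>
    optimalityConditions_of_ultrafilter hf hm g hY hYC hPC (hg hXC) (fun i => (hXP i).mono_left hg)
      (hYs.mono_left hg)
  -- Opial's argument by polarisation: if both distances converge, so does `⟪q - q', W n⟫`.
  -- Evaluated along two ultrafilters with limits `q` and `q'`, this gives `‖q - q'‖ ^ 2 = 0`.
  have hinner : ∀ (q q' : ProdSpace H m),
      (∃ L, Tendsto (fun n => ‖W n - q‖ ^ 2) atTop (𝓝 L)) →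
      (∃ L, Tendsto (fun n => ‖W n - q'‖ ^ 2) atTop (𝓝 L)) →
      ∃ c, Tendsto (fun n => inner ℝ (q - q') (Y n + γ • P n)) atTop (𝓝 c) := by
    rintro q q' ⟨L, hL⟩ ⟨L', hL'⟩
    have h1 : Tendsto (fun n => inner ℝ (q - q') (W n)) atTop
        (𝓝 ((L' - L + (‖q‖ ^ 2 - ‖q'‖ ^ 2)) / 2)) := by
      refine (((hL'.sub hL).add_const _).div_const 2).congr fun n => ?_
      rw [norm_sub_sq_real, norm_sub_sq_real, inner_sub_left, real_inner_comm (W n),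
        real_inner_comm (W n)]
      ring
    have h2 := ((tendsto_add_atTop_iff_nat 1).2 h1).add
      (tendsto_const_nhds (x := q - q').inner hαd)
    refine ⟨_, h2.congr fun n => ?_⟩
    rw [hu', inner_add_right]
  have hwlim : ∀ (g : Filter ℕ) (x : H) (v : ProdSpace H m),
      (∀ i, InnerTendsto g (fun n => P n i) x) → (∀ i, InnerTendsto g (fun n => Y n i) (v i)) →
      InnerTendsto g (fun n => Y n + γ • P n) (splittingPoint γ x v) := by
    intro g x v hPg hYg q
    simp only [PiLp.inner_apply]
    exact tendsto_finsetSum _ fun i _ => ((hYg i).add ((hPg i).const_smul γ)) (q i)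
  obtain ⟨x, v, h, hPg, hYg⟩ := hcluster (Ultrafilter.of atTop) (Ultrafilter.of_le _)
  have huniq : ∀ g : Ultrafilter ℕ, (g : Filter ℕ) ≤ atTop →
      (∀ i, InnerTendsto (g : Filter ℕ) (fun n => P n i) x) ∧
      ∀ i, InnerTendsto (g : Filter ℕ) (fun n => Y n i) (v i) := by
    intro g hg
    obtain ⟨x', v', h', hPg', hYg'⟩ := hcluster g hg
    obtain ⟨c, hc⟩ := hinner _ _ (hKM x v h).2 (hKM x' v' h').2
    have e1 := tendsto_nhds_unique (hc.mono_left (Ultrafilter.of_le _)) (hwlim _ x v hPg hYg _)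
    have e2 := tendsto_nhds_unique (hc.mono_left hg) (hwlim _ x' v' hPg' hYg' _)
    have e3 : inner ℝ (splittingPoint γ x v - splittingPoint γ x' v')
        (splittingPoint γ x v - splittingPoint γ x' v') = 0 := by
      rw [inner_sub_right, ← e1, ← e2, sub_self]
    obtain ⟨rfl, rfl⟩ := h.eq_of_splittingPoint_eq hγ hm h' (sub_eq_zero.1 (inner_self_eq_zero.1 e3))
    exact ⟨hPg', hYg'⟩
  exact ⟨x, v, h, fun i => innerTendsto_iff_ultrafilter.2 fun g hg => (huniq g hg).1 i,
    fun i => innerTendsto_iff_ultrafilter.2 fun g hg => (huniq g hg).2 i, hXP, hd, hYs,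
    tendsto_sum_inner_zero (fun i => Eventually.of_forall fun n => hYC n i) hXC hXP hYs⟩

/-- The lower bound uses the subgradients `v i` at `x`, the upper bound the subgradients `Y n i` at
`P n i`; both tend to the optimal value. -/
theorem OptimalityConditions.tendsto_sum_values {x : H} {v : ProdSpace H m}
    (h : OptimalityConditions f x v) {r : Fin m → ℝ} (hr : ∀ i, f i x = r i)
    {Y P : ℕ → ProdSpace H m} {s : ℕ → Fin m → ℝ} (hY : ∀ n i, Y n i ∈ subdiff (f i) (P n i))
    (hs : ∀ n i, f i (P n i) = s n i) (hP : ∀ i, InnerTendsto atTop (fun n => P n i) x)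
    (hYs : Tendsto (fun n => ∑ i, Y n i) atTop (𝓝 0))
    (hYP : Tendsto (fun n => ∑ i, inner ℝ (Y n i) (P n i)) atTop (𝓝 0)) :
    Tendsto (fun n => ∑ i, s n i) atTop (𝓝 (∑ i, r i)) := by
  have hlow : Tendsto (fun n => ∑ i, r i + ∑ i, inner ℝ (v i) (P n i)) atTop (𝓝 (∑ i, r i)) := by
    have h1 := (tendsto_finsetSum Finset.univ fun i _ => hP i (v i)).const_add (∑ i, r i)
    rwa [h.sum_inner_eq_zero, add_zero] at h1
  have hup : Tendsto (fun n => ∑ i, r i - inner ℝ (∑ i, Y n i) x + ∑ i, inner ℝ (Y n i) (P n i))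
      atTop (𝓝 (∑ i, r i)) := by
    simpa using ((hYs.inner (tendsto_const_nhds (x := x))).const_sub (∑ i, r i)).add hYP
  refine tendsto_of_tendsto_of_tendsto_of_le_of_le hlow hup (fun n => ?_) (fun n => ?_)
  · exact h.sum_le hr fun i => (hs n i).le
  · have h1 := Finset.sum_le_sum fun i (_ : i ∈ Finset.univ) =>
      le_of_mem_subdiff (hY n i) (hs n i) (hr i).le
    simp only [inner_sub_right, Finset.sum_add_distrib, Finset.sum_sub_distrib, ← sum_inner] at h1
    simp only
    linarith

theorem OptimalityConditions.eq_of_isDualSolution (hf : ∀ i, IsGamma (f i)) {x : H}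
    {v v' : ProdSpace H m} (h : OptimalityConditions f x v)
    (hstr : ∀ i, IsStronglyConvex (fenchelConj (f i))) (hv' : IsDualSolution f v') : v' = v := by
  choose r hr using fun i => exists_coe_of_mem_subdiff (h.1 i)
  choose β hβ hgrow using fun i => exists_quadratic_growth_conj (hstr i) (h.1 i) (hr i)
  have hval := hv'.2 v h.2
  rw [h.dualObjective_eq hr, dualObjective, EReal.le_neg, ← EReal.coe_neg] at hval
  have hbot : ∀ i, fenchelConj (f i) (v' i) ≠ ⊥ := fun i => (hf i).fenchelConj_ne_bot _
  choose s hs using fun i => (⟨_, (EReal.coe_toReal (ne_top_of_finset_sum_ne_top hbot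
    (ne_top_of_le_ne_top (EReal.coe_ne_top _) hval) (Finset.mem_univ i)) (hbot i)).symm⟩ :
    ∃ c : ℝ, fenchelConj (f i) (v' i) = c)
  simp only [hs, ← coe_finset_sum_real, EReal.coe_le_coe_iff] at hval
  have h1 := Finset.sum_le_sum fun i (_ : i ∈ Finset.univ) => hgrow i _ _ (hs i)
  rw [Finset.sum_add_distrib, Finset.sum_sub_distrib, ← sum_inner, hv'.1, inner_zero_left] at h1
  have hnn : ∀ i ∈ Finset.univ, 0 ≤ β i * ‖v' i - v i‖ ^ 2 := fun i _ =>
    mul_nonneg (hβ i).le (sq_nonneg _)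
  have h2 := (Finset.sum_eq_zero_iff_of_nonneg hnn).1
    (le_antisymm (by linarith) (Finset.sum_nonneg hnn))
  ext i
  simpa [(hβ i).ne', sub_eq_zero] using h2 i (Finset.mem_univ i)

theorem OptimalityConditions.tendsto_of_stronglyConvex {x : H} {v : ProdSpace H m}
    (h : OptimalityConditions f x v) {r : Fin m → ℝ} (hr : ∀ i, f i x = r i)
    (hstr : ∀ i, IsStronglyConvex (fenchelConj (f i))) {Y : ℕ → ProdSpace H m}
    {c : ℕ → Fin m → ℝ} (hc : ∀ n i, fenchelConj (f i) (Y n i) = c n i)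
    (hlim : Tendsto (fun n => ∑ i, c n i) atTop (𝓝 (-∑ i, r i)))
    (hYs : Tendsto (fun n => ∑ i, Y n i) atTop (𝓝 0)) : Tendsto Y atTop (𝓝 v) := by
  choose β hβ hgrow using fun i => exists_quadratic_growth_conj (hstr i) (h.1 i) (hr i)
  have hgap : Tendsto (fun n => ∑ i, c n i + ∑ i, r i - inner ℝ (∑ i, Y n i) x) atTop (𝓝 0) := by
    simpa using (hlim.add_const (∑ i, r i)).sub (hYs.inner (tendsto_const_nhds (x := x)))
  have hle : ∀ n j, β j * ‖Y n j - v j‖ ^ 2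
      ≤ ∑ i, c n i + ∑ i, r i - inner ℝ (∑ i, Y n i) x := by
    intro n j
    have h1 := Finset.sum_le_sum fun i (_ : i ∈ Finset.univ) => hgrow i _ _ (hc n i)
    rw [Finset.sum_add_distrib, Finset.sum_sub_distrib, ← sum_inner] at h1
    have h2 := Finset.single_le_sum (f := fun i => β i * ‖Y n i - v i‖ ^ 2)
      (fun i _ => mul_nonneg (hβ i).le (sq_nonneg _)) (Finset.mem_univ j)
    simp only at h2
    linarith
  have hcoord : ∀ j, Tendsto (fun n => Y n j) atTop (𝓝 (v j)) := by
    intro j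
    rw [tendsto_iff_norm_sub_tendsto_zero]
    have h1 : Tendsto (fun n => β j * ‖Y n j - v j‖ ^ 2) atTop (𝓝 0) :=
      squeeze_zero (fun n => mul_nonneg (hβ j).le (sq_nonneg _)) (fun n => hle n j) hgap
    have h2 := (Real.continuous_sqrt.tendsto _).comp (h1.const_mul (β j)⁻¹)
    simpa [Function.comp_def, ← mul_assoc, inv_mul_cancel₀ (hβ j).ne', Real.sqrt_sq] using h2
  have h1 : Tendsto (fun n => WithLp.ofLp (Y n)) atTop (𝓝 (WithLp.ofLp v)) :=
    tendsto_pi_nhds.2 hcoord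
  exact ((PiLp.continuous_toLp 2 fun _ : Fin m => H).tendsto _).comp h1

end InertialADMM

namespace InertialADMM

variable {H : Type*} [NormedAddCommGroup H] [InnerProductSpace ℝ H] {m : ℕ}
  {f : Fin m → H → EReal}

theorem InnerTendsto.of_shift {u : ℕ → H} {a : H} (N : ℕ)
    (h : InnerTendsto atTop (fun n => u (n + N)) a) : InnerTendsto atTop u a :=
  fun w => (tendsto_add_atTop_iff_nat N).1 (h w)

/-! ### The algorithm rewritten as a Douglas–Rachford iteration -/

section Algorithm

variable {γ : ℝ} {α lam : ℕ → ℝ} {x : ℕ → H} {zbar z y : ℕ → ProdSpace H m}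

theorem IsAdmmSequence.mem_subdiff (hf : ∀ i, IsGamma (f i))
    (hseq : IsAdmmSequence f γ α lam x zbar z y) {k : ℕ} (hk : 1 ≤ k) (i : Fin m) :
    y (k + 1) i ∈ subdiff (f i) (z (k + 1) i + zbar (k + 1) i) := by
  have h := (hf i).mem_subdiff_of_prox (γ := γ) (b := zbar (k + 1) i)
    (c := -y k i - ((1 - lam k) * α k) • inertia γ y z k i)
    (e := lam k • x (k + 1) + (1 - lam k) • z k i) (z := z (k + 1) i) fun w => by
      simpa only [zObjective, sub_sub] using hseq.z_step k hk i w
  convert h using 1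
  rw [hseq.y_step k hk]
  module

/-- The `y`-step turns the inertia at `k + 1` into `λ_k γ (x^{k+1} - z_i^k) + (1 - λ_k) α_k d_i^k`,
so the correction is exactly the scaled extrapolation. -/
theorem IsAdmmSequence.smul_zbar (hγ : γ ≠ 0) (hseq : IsAdmmSequence f γ α lam x zbar z y) {k : ℕ}
    (hk : 1 ≤ k) (i : Fin m) :
    γ • zbar (k + 1) i = α (k + 1) • inertia γ y z (k + 1) i := by
  have h : inertia γ y z (k + 1) i = (lam k * γ) • (x (k + 1) - z k i)
      + ((1 - lam k) * α k) • inertia γ y z k i := by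
    conv_lhs => rw [inertia, Nat.add_sub_cancel, hseq.y_step k hk]
    module
  rw [h, hseq.zbar_step k hk, smul_add, smul_add, smul_smul, smul_smul, smul_smul, smul_smul]
  congr 2
  · ring
  · field_simp

theorem IsAdmmSequence.sum_eq_zero (hm : 0 < m) (hγ : γ ≠ 0)
    (hseq : IsAdmmSequence f γ α lam x zbar z y) {k : ℕ} (hk : 1 ≤ k) :
    ∑ i, (γ • (z (k + 1) i + zbar (k + 1) i) - y (k + 1) i - γ • x (k + 2)) = 0 := by
  have hm' : (m : ℝ) ≠ 0 := by exact_mod_cast hm.ne'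
  simp only [smul_add, hseq.smul_zbar hγ hk, Finset.sum_sub_distrib, Finset.sum_add_distrib,
    ← Finset.smul_sum, Finset.sum_const, Finset.card_univ, Fintype.card_fin,
    ← Nat.cast_smul_eq_nsmul ℝ]
  rw [hseq.x_step (k + 1) (by omega)]
  match_scalars <;> field_simp <;> ring

theorem IsAdmmSequence.extrapolation_eq (hγ : γ ≠ 0)
    (hseq : IsAdmmSequence f γ α lam x zbar z y) {k : ℕ} (hk : 1 ≤ k) :
    y (k + 1) + γ • z (k + 1) + α (k + 1) • (y (k + 1) + γ • z (k + 1) - (y k + γ • z k))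
      = y (k + 1) + γ • (z (k + 1) + zbar (k + 1)) := by
  ext i
  simp only [PiLp.add_apply, PiLp.smul_apply, PiLp.sub_apply]
  rw [smul_add γ, hseq.smul_zbar hγ hk, inertia, Nat.add_sub_cancel]
  module

theorem IsAdmmSequence.governing_step (hγ : γ ≠ 0)
    (hseq : IsAdmmSequence f γ α lam x zbar z y) {k : ℕ} (hk : 1 ≤ k) :
    y (k + 2) + γ • z (k + 2) = y (k + 1) + γ • (z (k + 1) + zbar (k + 1))
      + (lam (k + 1) / 2) • splittingResidual γ (x (k + 2)) (z (k + 1) + zbar (k + 1)) := by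
  ext i
  simp only [splittingResidual, PiLp.add_apply, PiLp.smul_apply]
  have h := hseq.smul_zbar hγ hk i
  rw [hseq.y_step (k + 1) (by omega), mul_smul, ← h]
  module

end Algorithm

/-! ### Relaxation bounds cleared of fractions -/

section Parameters

variable {γ a l σ δ : ℝ} {α lam : ℕ → ℝ}

theorem AdmmParameters.bound_nonneg (h : AdmmParameters γ a l σ δ α lam) : 0 ≤ a :=
  (h.alpha_bounds 2 le_rfl).1.trans (h.alpha_bounds 2 le_rfl).2

theorem AdmmParameters.relaxation_bound (h : AdmmParameters γ a l σ δ α lam) {k : ℕ} (hk : 2 ≤ k) :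
    (a + δ * (lam k / 2)) * (a * (1 + a) + a * δ + σ) + δ * (lam k / 2) ≤ δ := by
  have ha := h.bound_nonneg
  have hδ := h.delta_pos
  have hσ := h.sigma_pos
  have h1 : lam k / 2
      ≤ (δ - a * (a * (1 + a) + a * δ + σ)) / (δ * (1 + a * (1 + a) + a * δ + σ)) := by
    linarith [(h.lam_bounds k hk).2]
  rw [le_div_iff₀ (by positivity)] at h1
  linarith

theorem AdmmParameters.half_relaxation_le_one (h : AdmmParameters γ a l σ δ α lam) {k : ℕ}
    (hk : 2 ≤ k) : lam k / 2 ≤ 1 := by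
  have ha := h.bound_nonneg
  have hδ := h.delta_pos
  have hσ := h.sigma_pos
  have hl := h.l_pos.trans_le (h.lam_bounds k hk).1
  have h1 := h.relaxation_bound hk
  have h2 : 0 ≤ (a + δ * (lam k / 2)) * (a * (1 + a) + a * δ + σ) := by positivity
  refine le_of_mul_le_mul_left ?_ hδ
  linarith

end Parameters

end InertialADMM

/-! ### The convergence theorem -/

open InertialADMM
theorem mainTheorem3 {H : Type*} [NormedAddCommGroup H] [InnerProductSpace ℝ H] [CompleteSpace H]
    (m : ℕ) (hm : 2 ≤ m) (f : Fin m → H → EReal) (hf : ∀ i, IsGamma (f i))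
    (hsol : ∃ x : H, IsPrimalSolution f x) (hreg : RegularityCondition f)
    (γ a l σ δ : ℝ) (α lam : ℕ → ℝ) (hpar : AdmmParameters γ a l σ δ α lam)
    (x : ℕ → H) (zbar z y : ℕ → ProdSpace H m) (hseq : IsAdmmSequence f γ α lam x zbar z y) :
    ∃ (xbar : H) (vbar : ProdSpace H m),
      OptimalityConditions f xbar vbar ∧
      IsPrimalSolution f xbar ∧ IsDualSolution f vbar ∧ primalValue f = dualValue f ∧
      WeaklyTendsto x xbar ∧
      (∀ i, Tendsto (fun k => zbar k i) atTop (𝓝 0)) ∧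
      (∀ i, WeaklyTendsto (fun k => z k i) xbar) ∧
      (∀ i, Tendsto (fun k => x (k + 1) - z k i) atTop (𝓝 0)) ∧
      (∀ i, WeaklyTendsto (fun k => y k i) (vbar i)) ∧
      ((∀ i, IsStronglyConvex (fenchelConj (f i))) →
        (∀ v : ProdSpace H m, IsDualSolution f v → v = vbar) ∧ Tendsto y atTop (𝓝 vbar)) ∧
      Tendsto (fun k => ∑ i, f i (z k i + zbar k i)) atTop (𝓝 (primalValue f)) ∧
      Tendsto (fun k => -∑ i, fenchelConj (f i) (y k i)) atTop (𝓝 (dualValue f)) := by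
  have hm0 : 0 < m := by omega
  have hγ := hpar.gamma_pos
  obtain ⟨x₀, hx₀⟩ := hsol
  have hsub : ∀ n i, y (n + 2) i ∈ subdiff (f i) ((z (n + 2) + zbar (n + 2)) i) := fun n i =>
    hseq.mem_subdiff hf (k := n + 1) (by omega) i
  obtain ⟨xbar, vbar, hopt, hP, hY, hXP, hd, hYs, hYP⟩ := inertial_douglasRachford hf hm0 hγ
    -- Indices are shifted because the subgradient inclusion and the parameter bounds hold from `k =
    -- 2`; the pair `w^1`, `w^2` serves as starting data. The relaxation of the operator is half of
    -- `lam`.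
    (W := fun n => y (n + 1) + γ • z (n + 1)) (Y := fun n => y (n + 2))
    (P := fun n => z (n + 2) + zbar (n + 2)) (X := fun n => x (n + 3)) (α := fun n => α (n + 2))
    (η := fun n => lam (n + 2) / 2) (l := l / 2)
    ⟨x₀, exists_optimalityConditions hf hreg hx₀⟩
    (monotone_nat_of_le_succ fun n => hpar.monotone (n + 2) (by omega))
    (fun n => (hpar.alpha_bounds (n + 2) (by omega)).1)
    (fun n => (hpar.alpha_bounds (n + 2) (by omega)).2) hpar.a_lt_one (half_pos hpar.l_pos)
    (fun n => by linarith [(hpar.lam_bounds (n + 2) (by omega)).1])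
    (fun n => hpar.half_relaxation_le_one (by omega)) hpar.sigma_pos hpar.delta_pos
    (fun n => hpar.relaxation_bound (by omega)) hsub
    (fun n => hseq.sum_eq_zero hm0 hγ.ne' (k := n + 1) (by omega))
    (fun n => hseq.extrapolation_eq hγ.ne' (k := n + 1) (by omega))
    (fun n => hseq.governing_step hγ.ne' (k := n + 1) (by omega))
  have hzbar : ∀ i, Tendsto (fun k => zbar k i) atTop (𝓝 0) := by
    intro i
    rw [← tendsto_add_atTop_iff_nat 2]
    have hdi : Tendsto (fun n => inertia γ y z (n + 2) i) atTop (𝓝 0) := by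
      have hc : Continuous fun R : ProdSpace H m => R i := by fun_prop
      have h1 := (hc.tendsto 0).comp hd
      refine h1.congr fun n => ?_
      simp only [Function.comp_apply, inertia, PiLp.add_apply, PiLp.smul_apply, PiLp.sub_apply]
      rw [show n + 2 - 1 = n + 1 from rfl]
      module
    have h2 : Tendsto (fun n => γ⁻¹ * ‖inertia γ y z (n + 2) i‖) atTop (𝓝 0) := by
      simpa using (tendsto_zero_iff_norm_tendsto_zero.1 hdi).const_mul γ⁻¹
    refine squeeze_zero_norm (fun n => ?_) h2
    have hb := hpar.alpha_bounds (n + 2) (by omega)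
    have h3 := congrArg norm (hseq.smul_zbar hγ.ne' (k := n + 1) (by omega) i)
    rw [norm_smul, norm_smul, Real.norm_of_nonneg hγ.le, Real.norm_of_nonneg hb.1] at h3
    rw [le_inv_mul_iff₀ hγ, h3]
    exact mul_le_of_le_one_left (norm_nonneg _) (hb.2.trans hpar.a_lt_one.le)
  have hz : ∀ i, InnerTendsto atTop (fun k => z k i) xbar := by
    intro i
    refine InnerTendsto.of_shift 2 ?_
    have h1 := (hP i).add ((innerTendsto_of_tendsto
      ((tendsto_add_atTop_iff_nat 2).2 (hzbar i))).const_smul (-1))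
    simpa using h1
  have hxz : ∀ i, Tendsto (fun k => x (k + 1) - z k i) atTop (𝓝 0) := by
    intro i
    rw [← tendsto_add_atTop_iff_nat 2]
    have h1 := (hXP i).add ((tendsto_add_atTop_iff_nat 2).2 (hzbar i))
    rw [add_zero] at h1
    refine h1.congr fun n => ?_
    rw [PiLp.add_apply]
    abel
  have hx : InnerTendsto atTop x xbar := by
    refine InnerTendsto.of_shift 1 ?_
    have h1 := (hz ⟨0, hm0⟩).add (innerTendsto_of_tendsto (hxz ⟨0, hm0⟩))
    simpa using h1
  choose r hr using fun i => exists_coe_of_mem_subdiff (hopt.1 i)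
  choose s hs using fun n i => exists_coe_of_mem_subdiff (hsub n i)
  have hslim := hopt.tendsto_sum_values hr hsub hs hP hYs hYP
  have hconj := fun n i => fenchelConj_eq_of_mem_subdiff (hsub n i) (hs n i)
  have hclim : Tendsto (fun n => ∑ i, (inner ℝ (y (n + 2) i) ((z (n + 2) + zbar (n + 2)) i)
      - s n i)) atTop (𝓝 (-∑ i, r i)) := by
    simpa only [Finset.sum_sub_distrib, zero_sub] using hYP.sub hslim
  have hprimal := hopt.primalValue_eq hf hr
  have hdual := hopt.dualValue_eq hr
  refine ⟨xbar, vbar, hopt, hopt.isPrimalSolution hf, hopt.isDualSolution, hprimal.trans hdual.symm,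
    hx.weaklyTendsto, hzbar, fun i => (hz i).weaklyTendsto, hxz,
    fun i => (InnerTendsto.of_shift 2 (hY i)).weaklyTendsto,
    fun hstr => ⟨fun v hv => hopt.eq_of_isDualSolution hf hstr hv,
      (tendsto_add_atTop_iff_nat 2).1 (hopt.tendsto_of_stronglyConvex hr hstr hconj hclim hYs)⟩,
    ?_, ?_⟩
  · rw [hprimal, ← tendsto_add_atTop_iff_nat 2]
    refine (EReal.tendsto_coe.2 hslim).congr fun n => ?_
    rw [coe_finset_sum_real]
    exact Finset.sum_congr rfl fun i _ => (hs n i).symm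
  · rw [hdual, ← tendsto_add_atTop_iff_nat 2]
    have h1 := hclim.neg
    rw [neg_neg] at h1
    refine (EReal.tendsto_coe.2 h1).congr fun n => ?_
    rw [EReal.coe_neg, coe_finset_sum_real]
    exact congrArg _ (Finset.sum_congr rfl fun i _ => (hconj n i).symm)
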